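/- Let $M$ be a smooth finite-dimensional Riemannian manifold (without boundary) with Levi-Civita connection $\nabla$, covariant derivative $\frac{D}{dt}$ along curves and curvature tensor $R(X,Y)Z=\nabla_X\nabla_YZ-\nabla_Y\nabla_XZ-\nabla_{[X,Y]}Z$, and write $\frac{D^{k+1}x}{dt^{k+1}}$ for the $k$-th covariant derivative along $x$ of $\frac{dx}{dt}$. Let $S\subset M$ be an embedded submanifold, $T>0$, $\kappa\in\mathbb R$, and $n$ a natural number. For $i=1,\dots,n$ let $(p_0^i,v_0^i)\in TM$ and $p_T^i\in S$, and let $\Omega_i$ be the set of all $C^1$ piecewise smooth curves $x:[0,T]\to M$ with $x(0)=p_0^i$, $\frac{dx}{dt}(0)=v_0^i$, $x(T)=p_T^i$ and $\frac{dx}{dt}(T)\in T_{x(T)}S$. Let $V$ be a real function on $M^n$ that is $C^1$ on an open set $U\subset M^n$ (it may be singular outside $U$), and put $$J(x_1,\dots,x_n)=\int_0^T\Big(\frac12\sum_{i=1}^n\Big(\Big\|\frac{D^2x_i}{dt^2}\Big\|^2+\kappa\Big\|\frac{dx_i}{dt}\Big\|^2\Big)+V(x_1,\dots,x_n)\Big)dt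 .$$ Let $x_i\in\Omega_i$ for $i=1,\dots,n$, with $(x_1(t),\dots,x_n(t))\in U$ for all $t\in[0,T]$. For each $i$ let $\alpha_i:(-\epsilon,\epsilon)\times[0,T]\to M$ be an admissible variation of $x_i$: $\alpha_i$ is $C^1$, it is smooth on each strip $(-\epsilon,\epsilon)\times[s_{k-1},s_k]$ of some partition $0=s_0<\dots<s_N=T$, $\alpha_i(0,\cdot)=x_i$, and $\alpha_i(r,\cdot)\in\Omega_i$ for all $r\in(-\epsilon,\epsilon)$. Let $X_i(t)=\frac{\partial\alpha_i}{\partial r}(0,t)$ be its variational vector field, and let $0=t_0^i<t_1^i<\dots<t_{l_i}^i=T$ be a partition such that $x_i$ is smooth on each $[t_{j-1}^i,t_j^i]$. Then $J(\alpha_1(r,\cdot),\dots,\alpha_n(r,\cdot))$ is an integral of an integrable function for all $r$ near $0$, it is differentiable in $r$ at $r=0$, and $$\frac{d}{dr}\Big|_{r=0}J(\alpha_1(r,\cdot),\dots,\alpha_n(r,\cdot))=\int_0^T\sum_{i=1}^n\Big\langle X_i,\ \frac{D^4x_i}{dt^4}-\kappa\frac{D^2x_i}{dt^2}+R\Big(\frac{D^2x_i}{dt^2},\frac{dx_i}{dt}\Big)\frac{dx_i}{dt}+\mathrm{grad}_iV(x_1,\dots,x_n)\Big\rangle\,dt$$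 $$+\sum_{i=1}^n\sum_{j=1}^{l_i}\Big[\Big\langle\frac{DX_i}{dt},\frac{D^2x_i}{dt^2}\Big\rangle+\Big\langle X_i,\ \kappa\frac{dx_i}{dt}-\frac{D^3x_i}{dt^3}\Big\rangle\Big]_{(t_{j-1}^i)^+}^{(t_j^i)^-},$$ where the integrand on the right is integrable, all the one-sided limits in the brackets exist, and $\mathrm{grad}_iV$ is the gradient of $V$ with respect to its $i$-th argument. -/

import Mathlib

open Set Filter Topology MeasureTheory Bundle
open scoped Manifold ContDiff

noncomputable section

namespace MultiAgent

/-! ### Levi-Civita calculus in charts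

`M` is a smooth manifold without boundary, modelled on the finite dimensional real vector space `E`,
with a smooth Riemannian metric on its tangent spaces. -/

section Riemannian

variable {E : Type*} [NormedAddCommGroup E] [NormedSpace ℝ E]
  {M : Type*} [TopologicalSpace M] [ChartedSpace E M] [IsManifold 𝓘(ℝ, E) ∞ M]

/-- Components in `E` of a tangent vector at `q`, in the preferred chart at `p`
(for `q` in the domain of that chart). -/
def toChart (p q : M) : TangentSpace 𝓘(ℝ, E) q →L[ℝ] E :=
  (trivializationAt E (TangentSpace 𝓘(ℝ, E) : M → Type _) p).continuousLinearMapAt ℝ q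

/-- The tangent vector at `q` with given components in the preferred chart at `p`. -/
def ofChart (p q : M) : E →L[ℝ] TangentSpace 𝓘(ℝ, E) q :=
  (trivializationAt E (TangentSpace 𝓘(ℝ, E) : M → Type _) p).symmL ℝ q

/-- The velocity `dx/dt` of a curve `x`, with time domain `s`. -/
def velocity (s : Set ℝ) (x : ℝ → M) (t : ℝ) : TangentSpace 𝓘(ℝ, E) (x t) :=
  mfderivWithin 𝓘(ℝ, ℝ) 𝓘(ℝ, E) x s t (1 : ℝ)

variable [RiemannianBundle (fun q : M ↦ TangentSpace 𝓘(ℝ, E) q)]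

/-- The metric tensor in the preferred chart at `p`: `metricInChart p y u v` is the inner product of
the tangent vectors with components `u` and `v` at the point with chart coordinates `y`. -/
def metricInChart (p : M) (y : E) : E →L[ℝ] E →L[ℝ] ℝ :=
  (innerSL ℝ (E := TangentSpace 𝓘(ℝ, E) ((extChartAt 𝓘(ℝ, E) p).symm y))).bilinearComp
    (ofChart p ((extChartAt 𝓘(ℝ, E) p).symm y)) (ofChart p ((extChartAt 𝓘(ℝ, E) p).symm y))

/-- Christoffel symbols of the first kind in the preferred chart at `p`, that is, the linear form
`w ↦ (1/2) (∂_u g(v, w) + ∂_v g(u, w) - ∂_w g(u, v))` at the point with coordinates `y`. -/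
def christoffelFirst (p : M) (y u v : E) : E →L[ℝ] ℝ :=
  (1 / 2 : ℝ) • (fderiv ℝ (metricInChart p) y u v + fderiv ℝ (metricInChart p) y v u
    - ((fderiv ℝ (metricInChart p) y).flip u).flip v)

/-- Christoffel symbols (of the second kind) of the Levi-Civita connection in the preferred chart
at `p`: the vector `Γ(u, v) = Γ^k_{ij} u^i v^j e_k`, obtained from the first kind by raising the index
with the inverse of the metric tensor. -/
def christoffel (p : M) (y u v : E) : E :=
  (metricInChart p y).inverse (christoffelFirst p y u v)

/-- The covariant derivative `DW/dt` of a vector field `W` along the curve `x` (with time domain `s`)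
for the Levi-Civita connection: its components in the chart at `x t` are
`dW^k/dt + Γ^k_{ij}(x) (dx^i/dt) W^j`. -/
def covDeriv (s : Set ℝ) (x : ℝ → M) (W : (t : ℝ) → TangentSpace 𝓘(ℝ, E) (x t)) (t : ℝ) :
    TangentSpace 𝓘(ℝ, E) (x t) :=
  ofChart (x t) (x t)
    (derivWithin (fun τ ↦ toChart (x t) (x τ) (W τ)) s t
      + christoffel (x t) (extChartAt 𝓘(ℝ, E) (x t) (x t))
          (toChart (x t) (x t) (velocity s x t)) (toChart (x t) (x t) (W t)))

/-- `velocityCovDeriv s x k` is the `k`-th covariant derivative along `x` of the velocity of `x`,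
that is, `D^{k+1} x / dt^{k+1}`. -/
def velocityCovDeriv (s : Set ℝ) (x : ℝ → M) (k : ℕ) :
    (t : ℝ) → TangentSpace 𝓘(ℝ, E) (x t) :=
  (covDeriv s x)^[k] (velocity s x)

/-- The curvature tensor `R(X, Y)Z = ∇_X ∇_Y Z - ∇_Y ∇_X Z - ∇_{[X, Y]} Z` at `q`. It is computed on the
vector fields with constant components in the chart at `q` (so that `[X, Y] = 0`), which gives
`∂_X Γ(Y, Z) - ∂_Y Γ(X, Z) + Γ(X, Γ(Y, Z)) - Γ(Y, Γ(X, Z))`. -/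
def curvature (q : M) (X Y Z : TangentSpace 𝓘(ℝ, E) q) : TangentSpace 𝓘(ℝ, E) q :=
  let y : E := extChartAt 𝓘(ℝ, E) q q
  let u : E := toChart q q X
  let v : E := toChart q q Y
  let w : E := toChart q q Z
  ofChart q q
    (fderiv ℝ (fun z ↦ christoffel q z v w) y u - fderiv ℝ (fun z ↦ christoffel q z u w) y v
      + christoffel q y u (christoffel q y v w) - christoffel q y v (christoffel q y u w))

/-- The gradient at `z i` of `V : M^n → ℝ` with respect to its `i`-th argument. -/
def partialGrad [FiniteDimensional ℝ E] {n : ℕ} (V : (Fin n → M) → ℝ) (i : Fin n)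
    (z : Fin n → M) : TangentSpace 𝓘(ℝ, E) (z i) :=
  haveI : FiniteDimensional ℝ (TangentSpace 𝓘(ℝ, E) (z i)) := inferInstanceAs (FiniteDimensional ℝ E)
  haveI : CompleteSpace (TangentSpace 𝓘(ℝ, E) (z i)) := FiniteDimensional.complete ℝ _
  (InnerProductSpace.toDual ℝ (TangentSpace 𝓘(ℝ, E) (z i))).symm
    (mvfderiv 𝓘(ℝ, E) (fun y : M ↦ V (Function.update z i y)) (z i))

/-- The integrand of the energy of the `n` trajectories `x` on `[0, T]`. -/
def energyDensity {n : ℕ} (V : (Fin n → M) → ℝ) (κ T : ℝ) (x : Fin n → ℝ → M) (t : ℝ) : ℝ :=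
  (1 / 2) * ∑ i, (‖velocityCovDeriv (E := E) (Icc 0 T) (x i) 1 t‖ ^ 2
    + κ * ‖velocity (E := E) (Icc 0 T) (x i) t‖ ^ 2)
  + V (fun i ↦ x i t)

/-- The energy
`J(x) = ∫_0^T ((1/2) ∑_i (‖D²x_i/dt²‖² + κ ‖dx_i/dt‖²) + V(x_1, …, x_n)) dt`. -/
def energy {n : ℕ} (V : (Fin n → M) → ℝ) (κ T : ℝ) (x : Fin n → ℝ → M) : ℝ :=
  ∫ t in (0 : ℝ)..T, energyDensity (E := E) V κ T x t

end Riemannian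

/-! ### Admissible curves and variations -/

/-- `0 = t 0 < t 1 < ⋯ < t l = T`. -/
structure IsPartition (T : ℝ) {l : ℕ} (t : Fin (l + 1) → ℝ) : Prop where
  zero : t 0 = 0
  last : t (Fin.last l) = T
  strictMono : StrictMono t

section Curves

variable {E : Type*} [NormedAddCommGroup E] [NormedSpace ℝ E]
  {M : Type*} [TopologicalSpace M] [ChartedSpace E M]
  {F : Type*} [NormedAddCommGroup F] [NormedSpace ℝ F]
  {N : Type*} [TopologicalSpace N] [ChartedSpace F N]

/-- The curve `x` is smooth on each closed interval of the partition `t`. -/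
def IsSmoothOnPieces (E : Type*) [NormedAddCommGroup E] [NormedSpace ℝ E] {M : Type*}
    [TopologicalSpace M] [ChartedSpace E M] {l : ℕ} (t : Fin (l + 1) → ℝ) (x : ℝ → M) : Prop :=
  ∀ j : Fin l, ContMDiffOn 𝓘(ℝ, ℝ) 𝓘(ℝ, E) ∞ x (Icc (t j.castSucc) (t j.succ))

/-- The admissible set of curves on `[0, T]` for the submanifold `S = ι(N)` of `M`: the `C^1` piecewise
smooth curves `x` such that `(x(0), dx/dt(0))` is the given point `P` of `TM`, such that `x(T)` is the
given point `ι(q)` of `S`, and such that `dx/dt(T)` is tangent to `S`. Only the values on `[0, T]` of a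
function `x : ℝ → M` matter. -/
structure IsAdmissibleCurve (T : ℝ) (ι : N → M) (P : TangentBundle 𝓘(ℝ, E) M) (q : N)
    (x : ℝ → M) : Prop where
  contMDiffOn : ContMDiffOn 𝓘(ℝ, ℝ) 𝓘(ℝ, E) 1 x (Icc 0 T)
  piecewise : ∃ (l : ℕ) (t : Fin (l + 1) → ℝ), IsPartition T t ∧ IsSmoothOnPieces E t x
  initial : (⟨x 0, velocity (Icc 0 T) x 0⟩ : TangentBundle 𝓘(ℝ, E) M) = P
  final : ∃ w : TangentSpace 𝓘(ℝ, F) q,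
    (⟨x T, velocity (Icc 0 T) x T⟩ : TangentBundle 𝓘(ℝ, E) M)
      = tangentMap 𝓘(ℝ, F) 𝓘(ℝ, E) ι ⟨q, w⟩

/-- `α : (-ε, ε) × [0, T] → M`, `α r t = α_r(t)`, is a `C^1` piecewise smooth variation of the curve
`x` through admissible curves. -/
structure IsAdmissibleVariation (T : ℝ) (ι : N → M) (P : TangentBundle 𝓘(ℝ, E) M) (q : N)
    (x : ℝ → M) (ε : ℝ) (α : ℝ → ℝ → M) : Prop where
  contMDiffOn : ContMDiffOn 𝓘(ℝ, ℝ × ℝ) 𝓘(ℝ, E) 1 (Function.uncurry α) (Ioo (-ε) ε ×ˢ Icc 0 T)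
  piecewise : ∃ (l : ℕ) (t : Fin (l + 1) → ℝ), IsPartition T t ∧
    ∀ j : Fin l, ContMDiffOn 𝓘(ℝ, ℝ × ℝ) 𝓘(ℝ, E) ∞ (Function.uncurry α)
      (Ioo (-ε) ε ×ˢ Icc (t j.castSucc) (t j.succ))
  zero : α 0 = x
  admissible : ∀ r ∈ Ioo (-ε) ε, IsAdmissibleCurve (F := F) T ι P q (α r)

/-- `X` is the variational vector field `X(t) = ∂α/∂r (0, t)` along `x = α_0` on `[0, T]`. -/
def IsVariationField (T : ℝ) (x : ℝ → M) (α : ℝ → ℝ → M)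
    (X : (t : ℝ) → TangentSpace 𝓘(ℝ, E) (x t)) : Prop :=
  ∀ t ∈ Icc 0 T, (⟨x t, X t⟩ : TangentBundle 𝓘(ℝ, E) M)
    = ⟨α 0 t, velocity univ (fun r ↦ α r t) 0⟩

end Curves

section FirstVariation

variable {E : Type*} [NormedAddCommGroup E] [NormedSpace ℝ E]
  {M : Type*} [TopologicalSpace M] [ChartedSpace E M] [IsManifold 𝓘(ℝ, E) ∞ M]
  [RiemannianBundle (fun q : M ↦ TangentSpace 𝓘(ℝ, E) q)]

/-- The left hand side of the Euler-Lagrange equation of agent `i`: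
`D⁴x_i/dt⁴ - κ D²x_i/dt² + R(D²x_i/dt², dx_i/dt) dx_i/dt + grad_i V(x_1, …, x_n)`. -/
def eulerLagrange [FiniteDimensional ℝ E] {n : ℕ} (V : (Fin n → M) → ℝ) (κ T : ℝ)
    (x : Fin n → ℝ → M) (i : Fin n) (t : ℝ) : TangentSpace 𝓘(ℝ, E) (x i t) :=
  velocityCovDeriv (Icc 0 T) (x i) 3 t - κ • velocityCovDeriv (Icc 0 T) (x i) 1 t
    + curvature (x i t) (velocityCovDeriv (Icc 0 T) (x i) 1 t) (velocity (Icc 0 T) (x i) t)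
        (velocity (Icc 0 T) (x i) t)
    + partialGrad V i (fun k ↦ x k t)

/-- The boundary expression `⟨DX/dt, D²x/dt²⟩ + ⟨X, κ dx/dt - D³x/dt³⟩`. -/
def boundaryTerm (κ T : ℝ) (x : ℝ → M) (X : (t : ℝ) → TangentSpace 𝓘(ℝ, E) (x t)) (t : ℝ) : ℝ :=
  inner ℝ (covDeriv (Icc 0 T) x X t) (velocityCovDeriv (Icc 0 T) x 1 t)
    + inner ℝ (X t) (κ • velocity (Icc 0 T) x t - velocityCovDeriv (Icc 0 T) x 2 t)

end FirstVariation

end MultiAgent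

end

/-!
The proof differentiates the energy under the integral sign and integrates by parts twice, one
trajectory at a time; the boundary terms appear as the jumps of the boundary expression over a
partition.

Let `α` be a variation of one trajectory, smooth on the strips of a partition `s`. On a strip the
`r`-derivative of the density `(1/2) (‖D²α/∂t²‖² + κ ‖∂α/∂t‖²)` is computed with three facts about
the Levi-Civita connection: covariant derivatives along `α` are compatible with the metric
(`fderivWithin_inner_eq`), `D/∂r ∂α/∂t = D/∂t ∂α/∂r` since there is no torsion
(`covAlong_dirVel_comm`), and the commutator of `D/∂r` and `D/∂t` is the curvature
(`covAlong_covAlong_sub`). Together with the symmetry `⟨R(X, Y)Y, Z⟩ = ⟨R(Z, Y)Y, X⟩` they show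
that this derivative is `⟨X, D⁴x/dt⁴ - κ D²x/dt² + R(D²x/dt², dx/dt)dx/dt⟩` plus the
`t`-derivative of the boundary expression `⟨DX/dt, D²x/dt²⟩ + ⟨X, κ dx/dt - D³x/dt³⟩`
(`fderivWithin_stripDensity`).

The connection is given by Christoffel symbols in the preferred chart at each single point, so
these facts need the transformation law of the Christoffel symbols: it shows that the covariant
derivative has the usual expression in every chart, near every point of its domain
(`toChart_covAlong`).

The partition `s` of the variation and the partition `τ` over which the jumps are summed are
unrelated. On a piece of `τ` the trajectory is smooth, while `X` is only piecewise smooth; but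
`DX/dt` agrees off the points of `s` with the derivative `D/∂r` of the velocities `∂α/∂t`, and
this one is continuous on `[0, T]` because `α` is `C¹` (`varVelocity`). Hence the boundary
expression extends continuously to each piece of `τ`, and the fundamental theorem of calculus with
a finite exceptional set (`IsPartition.integral_eq_sum_jumps`) evaluates the integral of its
derivative.

The potential is `C¹` along the variation, for `r` near `0` by compactness of `[0, T]`, and the
chain rule in a product of charts gives its derivative in terms of the partial gradients
(`firstVariation_potential`).
-/

noncomputable section

namespace MultiAgent

/-! ### Norms on iterated spaces of linear maps -/

section Shortcuts

variable {A B : Type*} [NormedAddCommGroup A] [NormedSpace ℝ A] [NormedAddCommGroup B]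
  [NormedSpace ℝ B]

/-- Shortcut for instance search, used locally with high priority: the default search for the norm
on iterated spaces of continuous linear maps is slow. -/
@[reducible]
def clmNormedAddCommGroup : NormedAddCommGroup (A →L[ℝ] B) :=
  ContinuousLinearMap.toNormedAddCommGroup

/-- Shortcut for instance search, see `clmNormedAddCommGroup`. -/
@[reducible]
def clmSeminormedAddCommGroup : SeminormedAddCommGroup (A →L[ℝ] B) :=
  ContinuousLinearMap.toSeminormedAddCommGroup

/-- Shortcut for instance search, see `clmNormedAddCommGroup`. -/
@[reducible]
def clmNormedSpace : NormedSpace ℝ (A →L[ℝ] B) :=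
  ContinuousLinearMap.toNormedSpace

end Shortcuts

attribute [local instance 5000] clmNormedAddCommGroup
attribute [local instance 5000] clmSeminormedAddCommGroup
attribute [local instance 5000] clmNormedSpace

/-! ### Calculus of families of linear and bilinear maps -/

section FiniteDimensionalCalculus

variable {E : Type*} [NormedAddCommGroup E] [NormedSpace ℝ E]

/-- A family of linear maps on a finite dimensional space is `C^n` if its values are, at a point. -/
theorem contDiffAt_clm_apply_iff {D F : Type*} [NormedAddCommGroup D] [NormedSpace ℝ D]
    [NormedAddCommGroup F] [NormedSpace ℝ F] {n : ℕ∞ω} {f : D → E →L[ℝ] F} {x : D}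
    [FiniteDimensional ℝ E] :
    ContDiffAt ℝ n f x ↔ ∀ v, ContDiffAt ℝ n (fun y ↦ f y v) x := by
  refine ⟨fun h v ↦ h.clm_apply contDiffAt_const, fun h ↦ ?_⟩
  let d := Module.finrank ℝ E
  have hd : d = Module.finrank ℝ (Fin d → ℝ) := (Module.finrank_fin_fun ℝ).symm
  let e₁ := ContinuousLinearEquiv.ofFinrankEq hd
  let e₂ := (e₁.arrowCongr (1 : F ≃L[ℝ] F)).trans (ContinuousLinearEquiv.piRing (Fin d))
  rw [← Function.id_comp f, ← e₂.symm_comp_self]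
  exact e₂.symm.contDiff.contDiffAt.comp x (contDiffAt_pi.mpr fun i ↦ h _)

theorem contDiffAt_clm_apply₂_iff {D : Type*} [NormedAddCommGroup D] [NormedSpace ℝ D]
    {F : Type*} [NormedAddCommGroup F] [NormedSpace ℝ F] {n : ℕ∞ω} {f : D → E →L[ℝ] E →L[ℝ] F}
    {x : D} [FiniteDimensional ℝ E] :
    ContDiffAt ℝ n f x ↔ ∀ u v, ContDiffAt ℝ n (fun y ↦ f y u v) x := by
  rw [contDiffAt_clm_apply_iff]
  exact forall_congr' fun u ↦ contDiffAt_clm_apply_iff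

theorem _root_.ContDiffAt.fderiv_apply_const {D F : Type*} [NormedAddCommGroup D]
    [NormedSpace ℝ D] [NormedAddCommGroup F] [NormedSpace ℝ F] {f : D → F} {x : D}
    (hf : ContDiffAt ℝ ∞ f x) (u : D) : ContDiffAt ℝ ∞ (fun y ↦ fderiv ℝ f y u) x :=
  (hf.fderiv_right (m := ∞) (by simp)).clm_apply contDiffAt_const

theorem hasFDerivWithinAt_comp_fderiv {P Q F : Type*} [NormedAddCommGroup P] [NormedSpace ℝ P]
    [NormedAddCommGroup Q] [NormedSpace ℝ Q] [NormedAddCommGroup F] [NormedSpace ℝ F]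
    {f : Q → F} {φ : P → Q} {D : Set P} {z : P}
    (hf : DifferentiableAt ℝ f (φ z)) (hφ : DifferentiableWithinAt ℝ φ D z) :
    HasFDerivWithinAt (fun z ↦ f (φ z)) ((fderiv ℝ f (φ z)).comp (fderivWithin ℝ φ D z)) D z :=
  hf.hasFDerivAt.comp_hasFDerivWithinAt z hφ.hasFDerivWithinAt

theorem fderivWithin_bilinear_apply {P Q A B C : Type*} [NormedAddCommGroup P] [NormedSpace ℝ P]
    [NormedAddCommGroup Q] [NormedSpace ℝ Q]
    [NormedAddCommGroup A] [NormedSpace ℝ A] [NormedAddCommGroup B] [NormedSpace ℝ B]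
    [NormedAddCommGroup C] [NormedSpace ℝ C] {f : Q → A →L[ℝ] B →L[ℝ] C} {φ : P → Q} {u : P → A}
    {v : P → B} {D : Set P} {z : P} (hD : UniqueDiffWithinAt ℝ D z)
    (hf : DifferentiableAt ℝ f (φ z)) (hφ : DifferentiableWithinAt ℝ φ D z)
    (hu : DifferentiableWithinAt ℝ u D z) (hv : DifferentiableWithinAt ℝ v D z) (e : P) :
    fderivWithin ℝ (fun z ↦ f (φ z) (u z) (v z)) D z e
      = fderiv ℝ f (φ z) (fderivWithin ℝ φ D z e) (u z) (v z)
        + f (φ z) (fderivWithin ℝ u D z e) (v z) + f (φ z) (u z) (fderivWithin ℝ v D z e) := by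
  have h := hasFDerivWithinAt_comp_fderiv hf hφ
  rw [((h.clm_apply hu.hasFDerivWithinAt).clm_apply hv.hasFDerivWithinAt).fderivWithin hD]
  simp only [add_apply, ContinuousLinearMap.flip_apply, ContinuousLinearMap.comp_apply]
  abel

theorem fderiv_bilinear_apply {P Q A B C : Type*} [NormedAddCommGroup P] [NormedSpace ℝ P]
    [NormedAddCommGroup Q] [NormedSpace ℝ Q]
    [NormedAddCommGroup A] [NormedSpace ℝ A] [NormedAddCommGroup B] [NormedSpace ℝ B]
    [NormedAddCommGroup C] [NormedSpace ℝ C] {f : Q → A →L[ℝ] B →L[ℝ] C} {φ : P → Q} {u : P → A}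
    {v : P → B} {z : P} (hf : DifferentiableAt ℝ f (φ z)) (hφ : DifferentiableAt ℝ φ z)
    (hu : DifferentiableAt ℝ u z) (hv : DifferentiableAt ℝ v z) (e : P) :
    fderiv ℝ (fun z ↦ f (φ z) (u z) (v z)) z e
      = fderiv ℝ f (φ z) (fderiv ℝ φ z e) (u z) (v z) + f (φ z) (fderiv ℝ u z e) (v z)
        + f (φ z) (u z) (fderiv ℝ v z e) := by
  simp only [← fderivWithin_univ (f := φ), ← fderivWithin_univ (f := u),
    ← fderivWithin_univ (f := v), ← fderivWithin_univ (f := fun z ↦ f (φ z) (u z) (v z))]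
  exact fderivWithin_bilinear_apply uniqueDiffWithinAt_univ hf hφ.differentiableWithinAt
    hu.differentiableWithinAt hv.differentiableWithinAt e

theorem fderiv_apply_const {P A B : Type*} [NormedAddCommGroup P] [NormedSpace ℝ P]
    [NormedAddCommGroup A] [NormedSpace ℝ A] [NormedAddCommGroup B] [NormedSpace ℝ B]
    {f : P → A →L[ℝ] B} {z : P} (hf : DifferentiableAt ℝ f z) (u : A) (e : P) :
    fderiv ℝ (fun z ↦ f z u) z e = fderiv ℝ f z e u := by
  rw [(hf.hasFDerivAt.clm_apply (hasFDerivAt_const u z)).fderiv]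
  simp

theorem fderiv_bilinear_const {A B C P : Type*} [NormedAddCommGroup P] [NormedSpace ℝ P]
    [NormedAddCommGroup A] [NormedSpace ℝ A] [NormedAddCommGroup B] [NormedSpace ℝ B]
    [NormedAddCommGroup C] [NormedSpace ℝ C] {f : P → A →L[ℝ] B →L[ℝ] C}
    {z : P} (hf : DifferentiableAt ℝ f z) (u : A) (v : B) (e : P) :
    fderiv ℝ (fun z ↦ f z u v) z e = fderiv ℝ f z e u v := by
  have h : DifferentiableAt ℝ (fun z ↦ f z u) z := hf.clm_apply (differentiableAt_const u)
  rw [fderiv_apply_const h, fderiv_apply_const hf]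

end FiniteDimensionalCalculus

/-! ### Christoffel symbols and curvature of a metric on a vector space -/

section LocalMetric

variable {E : Type*} [NormedAddCommGroup E] [NormedSpace ℝ E]

/-- The Christoffel symbols of the first kind of a metric tensor `g` on an open subset of `E`. -/
def localChristoffelFirst (g : E → E →L[ℝ] E →L[ℝ] ℝ) (y u v : E) : E →L[ℝ] ℝ :=
  (1 / 2 : ℝ) • (fderiv ℝ g y u v + fderiv ℝ g y v u - ((fderiv ℝ g y).flip u).flip v)

theorem localChristoffelFirst_apply (g : E → E →L[ℝ] E →L[ℝ] ℝ) (y u v w : E) :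
    localChristoffelFirst g y u v w
      = (1 / 2 : ℝ) * (fderiv ℝ g y u v w + fderiv ℝ g y v u w - fderiv ℝ g y w u v) := rfl

/-- The Christoffel symbols of the second kind of a metric tensor `g` on an open subset of `E`. -/
def localChristoffel (g : E → E →L[ℝ] E →L[ℝ] ℝ) (y u v : E) : E :=
  (g y).inverse (localChristoffelFirst g y u v)

/-- `g` is smooth and symmetric near `y`, and nondegenerate at `y`. Positivity is not needed for the
Levi-Civita calculus. -/
structure IsMetricAt (g : E → E →L[ℝ] E →L[ℝ] ℝ) (y : E) : Prop where
  contDiffAt : ContDiffAt ℝ ∞ g y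
  symm : ∀ᶠ z in 𝓝 y, ∀ u v, g z u v = g z v u
  nondegenerate : ∃ e : E ≃L[ℝ] (E →L[ℝ] ℝ), (e : E →L[ℝ] (E →L[ℝ] ℝ)) = g y

variable [FiniteDimensional ℝ E]

/-- The Christoffel symbols of the second kind as a continuous bilinear map, a form in which their
smoothness in the base point can be stated. -/
def localChristoffelL (g : E → E →L[ℝ] E →L[ℝ] ℝ) (y : E) : E →L[ℝ] E →L[ℝ] E :=
  LinearMap.toContinuousLinearMap
    ((LinearMap.toContinuousLinearMap : (E →ₗ[ℝ] E) ≃ₗ[ℝ] (E →L[ℝ] E)).toLinearMap ∘ₗ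
      LinearMap.mk₂ ℝ (localChristoffel g y)
        (fun u u' v ↦ by
          rw [localChristoffel, localChristoffel, localChristoffel, ← map_add]
          congr 1; ext w
          simp only [localChristoffelFirst_apply, ContinuousLinearMap.map_add, add_apply]
          ring)
        (fun c u v ↦ by
          rw [localChristoffel, localChristoffel, ← map_smul]
          congr 1; ext w
          simp only [localChristoffelFirst_apply, ContinuousLinearMap.map_smul, smul_apply,
            smul_eq_mul]
          ring)
        (fun u v v' ↦ by
          rw [localChristoffel, localChristoffel, localChristoffel, ← map_add]
          congr 1; ext w
          simp only [localChristoffelFirst_apply, ContinuousLinearMap.map_add, add_apply]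
          ring)
        (fun c u v ↦ by
          rw [localChristoffel, localChristoffel, ← map_smul]
          congr 1; ext w
          simp only [localChristoffelFirst_apply, ContinuousLinearMap.map_smul, smul_apply,
            smul_eq_mul]
          ring))

theorem localChristoffelL_apply (g : E → E →L[ℝ] E →L[ℝ] ℝ) (y u v : E) :
    localChristoffelL g y u v = localChristoffel g y u v := rfl

namespace IsMetricAt

variable {g : E → E →L[ℝ] E →L[ℝ] ℝ} {y : E}

omit [FiniteDimensional ℝ E] in
theorem differentiableAt (h : IsMetricAt g y) : DifferentiableAt ℝ g y :=
  h.contDiffAt.differentiableAt (by simp)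

omit [FiniteDimensional ℝ E] in
theorem apply_localChristoffel (h : IsMetricAt g y) (u v w : E) :
    g y (localChristoffel g y u v) w
      = (1 / 2 : ℝ) * (fderiv ℝ g y u v w + fderiv ℝ g y v u w - fderiv ℝ g y w u v) := by
  obtain ⟨e, he⟩ := h.nondegenerate
  rw [← localChristoffelFirst_apply, localChristoffel, ← he, ContinuousLinearMap.inverse_equiv]
  exact DFunLike.congr_fun (e.apply_symm_apply _) w

omit [FiniteDimensional ℝ E] in
/-- Vectors with the same pairings are equal. -/
theorem ext (h : IsMetricAt g y) {u v : E} (huv : ∀ w, g y u w = g y v w) : u = v := by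
  obtain ⟨e, he⟩ := h.nondegenerate
  apply e.injective
  ext w
  have := huv w
  rwa [← he] at this

omit [FiniteDimensional ℝ E] in
theorem fderiv_symm (h : IsMetricAt g y) (u v w : E) : fderiv ℝ g y u v w = fderiv ℝ g y u w v := by
  rw [← fderiv_bilinear_const h.differentiableAt, ← fderiv_bilinear_const h.differentiableAt]
  have : (fun z ↦ g z v w) =ᶠ[𝓝 y] (fun z ↦ g z w v) := h.symm.mono fun z hz ↦ hz v w
  rw [this.fderiv_eq]

theorem contDiffAt_localChristoffelL (h : IsMetricAt g y) :
    ContDiffAt ℝ ∞ (localChristoffelL g) y := by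
  obtain ⟨e, he⟩ := h.nondegenerate
  have hinv : ContDiffAt ℝ ∞ (fun z ↦ (g z).inverse) y := by
    have h' := contDiffAt_map_inverse (n := ∞) e
    rw [he] at h'
    exact h'.comp _ h.contDiffAt
  have h1 := fun a b c : E ↦ ((h.contDiffAt.fderiv_apply_const
    a).clm_apply (contDiffAt_const (c := b))).clm_apply (contDiffAt_const (c := c))
  rw [contDiffAt_clm_apply₂_iff]
  intro u v
  refine hinv.clm_apply (contDiffAt_clm_apply_iff.2 fun w ↦ ?_)
  exact contDiffAt_const.mul (((h1 u v w).add (h1 v u w)).sub (h1 w u v))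

omit [FiniteDimensional ℝ E] in
/-- The Levi-Civita connection is torsion free. -/
theorem localChristoffel_symm (h : IsMetricAt g y) (u v : E) :
    localChristoffel g y u v = localChristoffel g y v u := by
  apply h.ext
  intro w
  rw [h.apply_localChristoffel, h.apply_localChristoffel, h.fderiv_symm w u v]
  ring

omit [FiniteDimensional ℝ E] in
/-- The Levi-Civita connection is metric: `∂_u g(v, w) = g(Γ(u, v), w) + g(v, Γ(u, w))`. -/
theorem fderiv_apply (h : IsMetricAt g y) (u v w : E) :
    fderiv ℝ g y u v w
      = g y (localChristoffel g y u v) w + g y v (localChristoffel g y u w) := by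
  rw [h.symm.self_of_nhds v, h.apply_localChristoffel, h.apply_localChristoffel,
    h.fderiv_symm u w v, h.fderiv_symm v u w, h.fderiv_symm w u v]
  ring

omit [FiniteDimensional ℝ E] in
/-- The inhomogeneous transformation law of the Christoffel symbols under a change of
coordinates `φ`. -/
theorem localChristoffel_transform {g' : E → E →L[ℝ] E →L[ℝ] ℝ} {φ : E → E}
    (h : IsMetricAt g y) (h' : IsMetricAt g' (φ y)) (hφ : ContDiffAt ℝ ∞ φ y)
    (hφs : Function.Surjective (fderiv ℝ φ y))
    (hg : ∀ᶠ z in 𝓝 y, ∀ u v, g z u v = g' (φ z) (fderiv ℝ φ z u) (fderiv ℝ φ z v)) (u v : E) :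
    fderiv ℝ φ y (localChristoffel g y u v)
      = localChristoffel g' (φ y) (fderiv ℝ φ y u) (fderiv ℝ φ y v)
        + fderiv ℝ (fderiv ℝ φ) y u v := by
  have hφ' : DifferentiableAt ℝ (fderiv ℝ φ) y :=
    (hφ.fderiv_right (m := ∞) (by simp)).differentiableAt (by simp)
  have hsymm : ∀ a b, fderiv ℝ (fderiv ℝ φ) y a b = fderiv ℝ (fderiv ℝ φ) y b a :=
    hφ.isSymmSndFDerivAt
      (by rw [minSmoothness_of_isRCLikeNormedField]; exact WithTop.coe_le_coe.2 le_top)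
  -- the derivative of the metric in the old coordinates
  have hd : ∀ a b c : E, fderiv ℝ g y a b c
      = fderiv ℝ g' (φ y) (fderiv ℝ φ y a) (fderiv ℝ φ y b) (fderiv ℝ φ y c)
        + g' (φ y) (fderiv ℝ (fderiv ℝ φ) y a b) (fderiv ℝ φ y c)
        + g' (φ y) (fderiv ℝ φ y b) (fderiv ℝ (fderiv ℝ φ) y a c) := by
    intro a b c
    have h2 : (fun z ↦ g z b c) =ᶠ[𝓝 y]
        fun z ↦ g' (φ z) (fderiv ℝ φ z b) (fderiv ℝ φ z c) := hg.mono fun z hz ↦ hz b c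
    have h3 : ∀ b, DifferentiableAt ℝ (fun z ↦ fderiv ℝ φ z b) y := fun b ↦
      hφ'.clm_apply (differentiableAt_const b)
    rw [← fderiv_bilinear_const h.differentiableAt, h2.fderiv_eq,
      fderiv_bilinear_apply h'.differentiableAt (hφ.differentiableAt (by simp)) (h3 b) (h3 c),
      fderiv_apply_const hφ', fderiv_apply_const hφ']
  apply h'.ext
  intro w'
  obtain ⟨w, rfl⟩ := hφs w'
  rw [← hg.self_of_nhds, h.apply_localChristoffel, map_add, add_apply,
    h'.apply_localChristoffel, hd, hd, hd, hsymm v u, hsymm w u, hsymm w v,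
    h'.symm.self_of_nhds (fderiv ℝ φ y v), h'.symm.self_of_nhds (fderiv ℝ φ y u)]
  ring

end IsMetricAt

/-- The curvature tensor `R(u, v)w` of a metric tensor `g` on an open subset of `E`. -/
def localCurvature (g : E → E →L[ℝ] E →L[ℝ] ℝ) (y u v w : E) : E :=
  fderiv ℝ (fun z ↦ localChristoffel g z v w) y u - fderiv ℝ (fun z ↦ localChristoffel g z u w) y v
    + localChristoffel g y u (localChristoffel g y v w)
    - localChristoffel g y v (localChristoffel g y u w)

section Curvature

variable {g : E → E →L[ℝ] E →L[ℝ] ℝ} {y : E}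

omit [FiniteDimensional ℝ E] in
theorem localCurvature_antisymm (u v w : E) :
    localCurvature g y u v w = -localCurvature g y v u w := by
  simp only [localCurvature]
  abel

omit [FiniteDimensional ℝ E] in
/-- The first Bianchi identity. -/
theorem localCurvature_bianchi (h : ∀ᶠ z in 𝓝 y, IsMetricAt g z) (u v w : E) :
    localCurvature g y u v w + localCurvature g y v w u + localCurvature g y w u v = 0 := by
  have hs : ∀ a b : E, fderiv ℝ (fun z ↦ localChristoffel g z a b) y
      = fderiv ℝ (fun z ↦ localChristoffel g z b a) y := fun a b ↦
    EventuallyEq.fderiv_eq (h.mono fun z hz ↦ hz.localChristoffel_symm a b)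
  have hs' := h.self_of_nhds.localChristoffel_symm
  simp only [localCurvature]
  rw [hs w v, hs w u, hs v u, hs' w v, hs' w u, hs' v u]
  abel

theorem IsMetricAt.differentiableAt_localChristoffel (h : IsMetricAt g y) (u v : E) :
    DifferentiableAt ℝ (fun z ↦ localChristoffel g z u v) y :=
  ((h.contDiffAt_localChristoffelL.differentiableAt (by simp)).clm_apply
    (differentiableAt_const u)).clm_apply (differentiableAt_const v)

/-- The curvature endomorphisms are skew, because second derivatives of `g` commute. -/
theorem apply_localCurvature_skew (h : ∀ᶠ z in 𝓝 y, IsMetricAt g z) (u v a b : E) :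
    g y (localCurvature g y u v a) b = -g y a (localCurvature g y u v b) := by
  have hy := h.self_of_nhds
  have hf : ContDiffAt ℝ ∞ (fun z ↦ g z a b) y :=
    (hy.contDiffAt.clm_apply contDiffAt_const).clm_apply contDiffAt_const
  have hsymm : IsSymmSndFDerivAt ℝ (fun z ↦ g z a b) y := hf.isSymmSndFDerivAt
    (by rw [minSmoothness_of_isRCLikeNormedField]; exact WithTop.coe_le_coe.2 le_top)
  have key : ∀ u v : E, fderiv ℝ (fderiv ℝ (fun z ↦ g z a b)) y u v
      = (g y (localChristoffel g y u (localChristoffel g y v a)) b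
          + g y (localChristoffel g y v a) (localChristoffel g y u b)
          + g y (fderiv ℝ (fun z ↦ localChristoffel g z v a) y u) b)
        + (g y (localChristoffel g y u a) (localChristoffel g y v b)
          + g y a (localChristoffel g y u (localChristoffel g y v b))
          + g y a (fderiv ℝ (fun z ↦ localChristoffel g z v b) y u)) := by
    intro u v
    have hd : DifferentiableAt ℝ (fderiv ℝ (fun z ↦ g z a b)) y :=
      (hf.fderiv_right (m := ∞) (by simp)).differentiableAt (by simp)
    have he : (fun z ↦ fderiv ℝ (fun z ↦ g z a b) z v) =ᶠ[𝓝 y]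
        fun z ↦ g z (localChristoffel g z v a) b + g z a (localChristoffel g z v b) :=
      h.mono fun z hz ↦ by
        simp only
        rw [fderiv_bilinear_const hz.differentiableAt, hz.fderiv_apply]
    have h1 := hy.differentiableAt_localChristoffel v a
    have h2 := hy.differentiableAt_localChristoffel v b
    have h3 := fderiv_bilinear_apply (φ := fun z ↦ z) (v := fun _ ↦ b) hy.differentiableAt
      differentiableAt_fun_id h1 (differentiableAt_const b) u
    have h4 := fderiv_bilinear_apply (φ := fun z ↦ z) (u := fun _ ↦ a) hy.differentiableAt
      differentiableAt_fun_id (differentiableAt_const a) h2 u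
    rw [← fderiv_apply_const hd, he.fderiv_eq, fderiv_fun_add
      ((hy.differentiableAt.clm_apply h1).clm_apply (differentiableAt_const b))
      ((hy.differentiableAt.clm_apply (differentiableAt_const a)).clm_apply h2), add_apply, h3, h4]
    simp [hy.fderiv_apply]
  have h1 := key u v
  rw [hsymm u v, key v u] at h1
  simp only [localCurvature, map_add, map_sub, add_apply, sub_apply]
  linarith

/-- The Jacobi operator `u ↦ R(u, v)v` is symmetric. -/
theorem apply_localCurvature_pair_symm (h : ∀ᶠ z in 𝓝 y, IsMetricAt g z) (u v w : E) :
    g y (localCurvature g y u v v) w = g y (localCurvature g y w v v) u := by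
  have hs := h.self_of_nhds.symm.self_of_nhds
  have h0 : g y (localCurvature g y w u v) v = 0 := by
    have := apply_localCurvature_skew h w u v v
    rw [hs v] at this
    linarith
  have h1 := congrArg (fun a ↦ g y a v) (localCurvature_bianchi h v w u)
  simp only [map_add, map_zero, add_apply, zero_apply] at h1
  rw [h0] at h1
  have h2 := apply_localCurvature_skew h u v w v
  rw [hs w] at h2
  have h3 := apply_localCurvature_skew h v w u v
  rw [localCurvature_antisymm v w v, hs u] at h3
  simp only [map_neg, neg_apply] at h3
  linarith

end Curvature

end LocalMetric

/-! ### Charts and tangent vectors -/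

section Charts

variable {E : Type*} [NormedAddCommGroup E] [NormedSpace ℝ E]
  {M : Type*} [TopologicalSpace M] [ChartedSpace E M]

theorem extChartAt_symm_extChartAt {p q : M} (hp : q ∈ (chartAt E p).source) :
    (extChartAt 𝓘(ℝ, E) p).symm (extChartAt 𝓘(ℝ, E) p q) = q :=
  (extChartAt 𝓘(ℝ, E) p).left_inv (by simpa using hp)

theorem extChartAt_target_mem_nhds_image {p q : M} (hp : q ∈ (chartAt E p).source) :
    (extChartAt 𝓘(ℝ, E) p).target ∈ 𝓝 (extChartAt 𝓘(ℝ, E) p q) :=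
  (isOpen_extChartAt_target p).mem_nhds
    ((extChartAt 𝓘(ℝ, E) p).map_source (by simpa using hp))

/-- A property that holds in chart coordinates at all points near `q` holds near the coordinates
of `q`. -/
theorem eventually_nhds_extChartAt {p q : M} (hp : q ∈ (chartAt E p).source) {C : E → Prop}
    (h : ∀ᶠ q' in 𝓝 q, q' ∈ (chartAt E p).source → C (extChartAt 𝓘(ℝ, E) p q')) :
    ∀ᶠ y in 𝓝 (extChartAt 𝓘(ℝ, E) p q), C y := by
  have hc : ContinuousAt (extChartAt 𝓘(ℝ, E) p).symm (extChartAt 𝓘(ℝ, E) p q) :=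
    continuousAt_extChartAt_symm' (by simpa using hp)
  rw [ContinuousAt, extChartAt_symm_extChartAt hp] at hc
  filter_upwards [hc.eventually h, extChartAt_target_mem_nhds_image hp] with y hy hT
  have := hy (by simpa using (extChartAt 𝓘(ℝ, E) p).map_target hT)
  rwa [(extChartAt 𝓘(ℝ, E) p).right_inv hT] at this

/-- The change of coordinates from the preferred chart at `p` to the preferred chart at `c`. -/
def transition (p c : M) : E → E := extChartAt 𝓘(ℝ, E) c ∘ (extChartAt 𝓘(ℝ, E) p).symm

theorem transition_extChartAt {p c q : M} (hp : q ∈ (chartAt E p).source) :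
    transition p c (extChartAt 𝓘(ℝ, E) p q) = extChartAt 𝓘(ℝ, E) c q := by
  simp only [transition, Function.comp]
  rw [extChartAt_symm_extChartAt hp]

theorem contDiffWithinAt_extChartAt_comp {P : Type*} [NormedAddCommGroup P] [NormedSpace ℝ P]
    {n : ℕ∞ω} [IsManifold 𝓘(ℝ, E) n M] {p : M} {f : P → M} {D : Set P} {z : P}
    (hp : f z ∈ (chartAt E p).source) (hf : ContMDiffWithinAt 𝓘(ℝ, P) 𝓘(ℝ, E) n f D z) :
    ContDiffWithinAt ℝ n (fun z' ↦ extChartAt 𝓘(ℝ, E) p (f z')) D z := by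
  rw [← contMDiffWithinAt_iff_contDiffWithinAt]
  exact ((contMDiffWithinAt_iff_target_of_mem_source hp).1 hf).2

variable [IsManifold 𝓘(ℝ, E) ∞ M]

theorem contDiffAt_transition {p c q : M} (hp : q ∈ (chartAt E p).source)
    (hc : q ∈ (chartAt E c).source) :
    ContDiffAt ℝ ∞ (transition p c : E → E) (extChartAt 𝓘(ℝ, E) p q) := by
  have := contDiffWithinAt_ext_coord_change (I := 𝓘(ℝ, E)) (n := ∞) c p
    (y := extChartAt 𝓘(ℝ, E) p q) (by
      simp
      refine ⟨(chartAt E p).map_source hp, ?_⟩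
      rwa [(chartAt E p).left_inv hp])
  rw [ModelWithCorners.range_eq_univ, contDiffWithinAt_univ] at this
  exact this

theorem toChart_ofChart {p q : M} (hq : q ∈ (chartAt E p).source) (v : E) :
    toChart p q (ofChart p q v) = v :=
  (trivializationAt E (TangentSpace 𝓘(ℝ, E) : M → Type _) p).continuousLinearMapAt_symmL
    (by simpa using hq) v

theorem ofChart_toChart {p q : M} (hq : q ∈ (chartAt E p).source) (v : TangentSpace 𝓘(ℝ, E) q) :
    ofChart p q (toChart p q v) = v :=
  (trivializationAt E (TangentSpace 𝓘(ℝ, E) : M → Type _) p).symmL_continuousLinearMapAt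
    (by simpa using hq) v

theorem toChart_injective {p q : M} (hq : q ∈ (chartAt E p).source)
    {v w : TangentSpace 𝓘(ℝ, E) q} (h : toChart p q v = toChart p q w) : v = w := by
  rw [← ofChart_toChart hq v, h, ofChart_toChart hq w]

theorem toChart_eq_mfderiv {p q : M} (hp : q ∈ (chartAt E p).source) :
    toChart p q = mfderiv 𝓘(ℝ, E) 𝓘(ℝ, E) (extChartAt 𝓘(ℝ, E) p) q :=
  TangentBundle.continuousLinearMapAt_trivializationAt hp

/-- Components of tangent vectors transform by the derivative of the change of coordinates. -/
theorem toChart_transition {p c q : M} (hp : q ∈ (chartAt E p).source)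
    (hc : q ∈ (chartAt E c).source) (v : TangentSpace 𝓘(ℝ, E) q) :
    toChart c q v
      = fderiv ℝ (transition p c : E → E) (extChartAt 𝓘(ℝ, E) p q) (toChart p q v) := by
  have hev : (extChartAt 𝓘(ℝ, E) c : M → E) =ᶠ[𝓝 q]
      (transition p c : E → E) ∘ (extChartAt 𝓘(ℝ, E) p) := by
    filter_upwards [(chartAt E p).open_source.mem_nhds hp] with q' hq'
    exact (transition_extChartAt hq').symm
  have h1 : MDifferentiableAt 𝓘(ℝ, E) 𝓘(ℝ, E) (extChartAt 𝓘(ℝ, E) p) q :=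
    mdifferentiableAt_extChartAt hp
  have h2 : MDifferentiableAt 𝓘(ℝ, E) 𝓘(ℝ, E) (transition p c : E → E)
      (extChartAt 𝓘(ℝ, E) p q) :=
    ((contDiffAt_transition hp hc).differentiableAt (by simp)).mdifferentiableAt
  rw [toChart_eq_mfderiv hp, toChart_eq_mfderiv hc, hev.mfderiv_eq, mfderiv_comp q h2 h1,
    mfderiv_eq_fderiv]
  rfl

theorem fderiv_transition_surjective {p c q : M} (hp : q ∈ (chartAt E p).source)
    (hc : q ∈ (chartAt E c).source) :
    Function.Surjective (fderiv ℝ (transition p c : E → E) (extChartAt 𝓘(ℝ, E) p q)) := fun w ↦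
  ⟨toChart p q (ofChart c q w), by rw [← toChart_transition hp hc, toChart_ofChart hc]⟩

theorem toChart_mfderivWithin {P : Type*} [NormedAddCommGroup P] [NormedSpace ℝ P] {p : M}
    {f : P → M} {D : Set P} {z : P}
    (hp : f z ∈ (chartAt E p).source) (hf : MDifferentiableWithinAt 𝓘(ℝ, P) 𝓘(ℝ, E) f D z)
    (hD : UniqueDiffWithinAt ℝ D z) (e : P) :
    toChart p (f z) (mfderivWithin 𝓘(ℝ, P) 𝓘(ℝ, E) f D z e)
      = fderivWithin ℝ (fun z' ↦ extChartAt 𝓘(ℝ, E) p (f z')) D z e := by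
  have h1 : MDifferentiableAt 𝓘(ℝ, E) 𝓘(ℝ, E) (extChartAt 𝓘(ℝ, E) p) (f z) :=
    mdifferentiableAt_extChartAt hp
  have := mfderiv_comp_mfderivWithin z h1 hf hD.uniqueMDiffWithinAt
  rw [toChart_eq_mfderiv hp, ← mfderivWithin_eq_fderivWithin]
  change _ = mfderivWithin 𝓘(ℝ, P) 𝓘(ℝ, E) ((extChartAt 𝓘(ℝ, E) p) ∘ f) D z e
  rw [this]
  rfl

end Charts

/-! ### The metric in charts -/

section Metric

variable {E : Type*} [NormedAddCommGroup E] [NormedSpace ℝ E]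
  {M : Type*} [TopologicalSpace M] [ChartedSpace E M] [IsManifold 𝓘(ℝ, E) ∞ M]
  [RiemannianBundle (fun q : M ↦ TangentSpace 𝓘(ℝ, E) q)]

theorem metricInChart_apply (p : M) (y u v : E) :
    metricInChart p y u v = inner ℝ (ofChart p ((extChartAt 𝓘(ℝ, E) p).symm y) u)
      (ofChart p ((extChartAt 𝓘(ℝ, E) p).symm y) v) := rfl

theorem metricInChart_extChartAt {p q : M} (hp : q ∈ (chartAt E p).source) (u v : E) :
    metricInChart p (extChartAt 𝓘(ℝ, E) p q) u v = inner ℝ (ofChart p q u) (ofChart p q v) := by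
  rw [metricInChart_apply, extChartAt_symm_extChartAt hp]

theorem inner_eq_metricInChart {p q : M} (hp : q ∈ (chartAt E p).source)
    (v w : TangentSpace 𝓘(ℝ, E) q) :
    inner ℝ v w
      = metricInChart p (extChartAt 𝓘(ℝ, E) p q) (toChart p q v) (toChart p q w) := by
  rw [metricInChart_extChartAt hp, ofChart_toChart hp, ofChart_toChart hp]

theorem christoffel_eq (p : M) (y u v : E) :
    christoffel p y u v = localChristoffel (metricInChart p) y u v := rfl

theorem curvature_eq (q : M) (X Y Z : TangentSpace 𝓘(ℝ, E) q) :
    curvature q X Y Z = ofChart q q (localCurvature (metricInChart q) (extChartAt 𝓘(ℝ, E) q q)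
      (toChart q q X) (toChart q q Y) (toChart q q Z)) := rfl

variable [FiniteDimensional ℝ E]
  [IsContMDiffRiemannianBundle 𝓘(ℝ, E) ∞ E (fun p : M ↦ TangentSpace 𝓘(ℝ, E) p)]

theorem isMetricAt_metricInChart {p q : M} (hp : q ∈ (chartAt E p).source) :
    IsMetricAt (metricInChart p) (extChartAt 𝓘(ℝ, E) p q) where
  contDiffAt := by
    have hT := extChartAt_target_mem_nhds_image hp
    have hs : ∀ u : E, ContMDiffAt 𝓘(ℝ, E) (𝓘(ℝ, E).prod 𝓘(ℝ, E)) ∞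
        (fun y : E ↦ (⟨(extChartAt 𝓘(ℝ, E) p).symm y,
          ofChart p ((extChartAt 𝓘(ℝ, E) p).symm y) u⟩ : TangentBundle 𝓘(ℝ, E) M))
        (extChartAt 𝓘(ℝ, E) p q) := by
      intro u
      rw [Trivialization.contMDiffAt_iff
        (e := trivializationAt E (TangentSpace 𝓘(ℝ, E) : M → Type _) p)]
      · refine ⟨(contMDiffOn_extChartAt_symm p).contMDiffAt hT, ?_⟩
        refine (contMDiffAt_const (c := u)).congr_of_eventuallyEq ?_
        filter_upwards [hT] with y hy
        have hy' : (extChartAt 𝓘(ℝ, E) p).symm y ∈ (chartAt E p).source := by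
          simpa using (extChartAt 𝓘(ℝ, E) p).map_target hy
        have := toChart_ofChart hy' u
        rw [toChart, Trivialization.continuousLinearMapAt_apply,
          Trivialization.linearMapAt_apply, if_pos (by simpa using hy')] at this
        exact this
      · rw [Trivialization.mem_source, extChartAt_symm_extChartAt hp]
        simpa using hp
    rw [contDiffAt_clm_apply₂_iff]
    intro u v
    rw [← contMDiffAt_iff_contDiffAt]
    simp_rw [metricInChart_apply]
    have := ContMDiffAt.inner_bundle (F := E) (E := fun q : M ↦ TangentSpace 𝓘(ℝ, E) q)
      (IB := 𝓘(ℝ, E)) (n := ∞) (IM := 𝓘(ℝ, E)) (b := (extChartAt 𝓘(ℝ, E) p).symm)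
      (v := fun y ↦ ofChart p ((extChartAt 𝓘(ℝ, E) p).symm y) u)
      (w := fun y ↦ ofChart p ((extChartAt 𝓘(ℝ, E) p).symm y) v)
      (x := extChartAt 𝓘(ℝ, E) p q)
    exact this (hs u) (hs v)
  symm := Eventually.of_forall fun y u v ↦ by
    rw [metricInChart_apply, metricInChart_apply, real_inner_comm]
  nondegenerate := by
    set g := metricInChart p (extChartAt 𝓘(ℝ, E) p q) with hg
    have hinj : Function.Injective g := by
      rw [injective_iff_map_eq_zero]
      intro u hu
      have h0 : g u u = 0 := by rw [hu]; rfl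
      rw [hg, metricInChart_extChartAt hp, real_inner_self_eq_norm_sq] at h0
      have h1 : ofChart p q u = 0 := by simpa using h0
      rw [← toChart_ofChart hp u, h1, map_zero]
    have hdim : Module.finrank ℝ E = Module.finrank ℝ (E →L[ℝ] ℝ) := by
      rw [← (LinearMap.toContinuousLinearMap (𝕜 := ℝ) (E := E) (F' := ℝ)).finrank_eq]
      exact (Subspace.dual_finrank_eq).symm
    refine ⟨(LinearEquiv.ofInjectiveOfFinrankEq (g : E →ₗ[ℝ] (E →L[ℝ] ℝ)) hinj
      hdim).toContinuousLinearEquiv, ?_⟩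
    ext u v
    rfl

theorem eventually_isMetricAt_metricInChart {p q : M} (hp : q ∈ (chartAt E p).source) :
    ∀ᶠ y in 𝓝 (extChartAt 𝓘(ℝ, E) p q), IsMetricAt (metricInChart p) y :=
  eventually_nhds_extChartAt hp (Eventually.of_forall fun _ h ↦ isMetricAt_metricInChart h)

/-- The transformation law of the Christoffel symbols of `M` under a change of charts. -/
theorem christoffel_transition {p c q : M} (hp : q ∈ (chartAt E p).source)
    (hc : q ∈ (chartAt E c).source) (u v : E) :
    fderiv ℝ (transition p c) (extChartAt 𝓘(ℝ, E) p q)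
        (christoffel p (extChartAt 𝓘(ℝ, E) p q) u v)
      = christoffel c (extChartAt 𝓘(ℝ, E) c q)
          (fderiv ℝ (transition p c) (extChartAt 𝓘(ℝ, E) p q) u)
          (fderiv ℝ (transition p c) (extChartAt 𝓘(ℝ, E) p q) v)
        + fderiv ℝ (fderiv ℝ (transition p c)) (extChartAt 𝓘(ℝ, E) p q) u v := by
  rw [christoffel_eq, christoffel_eq, ← transition_extChartAt hp (c := c)]
  refine (isMetricAt_metricInChart hp).localChristoffel_transform (φ := transition p c)
    (by rw [transition_extChartAt hp]; exact isMetricAt_metricInChart hc)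
    (contDiffAt_transition hp hc) (fderiv_transition_surjective hp hc) ?_ u v
  refine eventually_nhds_extChartAt hp ?_
  filter_upwards [(chartAt E c).open_source.mem_nhds hc] with q' hc' hp' u v
  rw [transition_extChartAt hp', metricInChart_extChartAt hp', inner_eq_metricInChart hc',
    toChart_transition hp' hc', toChart_transition hp' hc', toChart_ofChart hp',
    toChart_ofChart hp']

/-- The Jacobi operator `X ↦ R(X, Y)Y` is symmetric. -/
theorem inner_curvature_symm (q : M) (X Y Z : TangentSpace 𝓘(ℝ, E) q) :
    inner ℝ (curvature q X Y Y) Z = inner ℝ (curvature q Z Y Y) X := by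
  have hq := mem_chart_source E q
  rw [inner_eq_metricInChart hq, inner_eq_metricInChart hq, curvature_eq, curvature_eq,
    toChart_ofChart hq, toChart_ofChart hq]
  exact apply_localCurvature_pair_symm (eventually_isMetricAt_metricInChart hq) _ _ _

end Metric

/-! ### Covariant derivatives of vector fields along parametrized maps -/

section Fields

variable {E : Type*} [NormedAddCommGroup E] [NormedSpace ℝ E]
  {M : Type*} [TopologicalSpace M] [ChartedSpace E M] [IsManifold 𝓘(ℝ, E) ∞ M]
  {P : Type*} [NormedAddCommGroup P] [NormedSpace ℝ P]
  {Q : Type*} [NormedAddCommGroup Q] [NormedSpace ℝ Q]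

/-- The derivative in the direction `e` of a map `f : P → M` with domain `D` in a vector space `P`:
with `P = ℝ` this is the velocity of a curve, with `P = ℝ × ℝ` it covers the partial derivatives of
a variation. -/
def dirVel (f : P → M) (D : Set P) (e : P) (z : P) : TangentSpace 𝓘(ℝ, E) (f z) :=
  mfderivWithin 𝓘(ℝ, P) 𝓘(ℝ, E) f D z e

/-- The vector field `W` along `f` is smooth on `D`, that is, its components in charts are. -/
def SmoothAlong (f : P → M) (D : Set P) (W : (z : P) → TangentSpace 𝓘(ℝ, E) (f z)) : Prop :=
  ∀ z ∈ D, ∀ p : M, f z ∈ (chartAt E p).source →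
    ContDiffWithinAt ℝ ∞ (fun z' ↦ toChart p (f z') (W z')) D z

variable {f : P → M} {D D' : Set P} {z e e₁ e₂ : P} {W Z : (z : P) → TangentSpace 𝓘(ℝ, E) (f z)}

theorem SmoothAlong.differentiableWithinAt (hW : SmoothAlong f D W) {p : M} (hz : z ∈ D)
    (hp : f z ∈ (chartAt E p).source) :
    DifferentiableWithinAt ℝ (fun z' ↦ toChart p (f z') (W z')) D z :=
  (hW z hz p hp).differentiableWithinAt (by simp)

omit [IsManifold 𝓘(ℝ, E) ∞ M] in
theorem eventually_mem_chart_source {p : M} (hf : ContMDiffOn 𝓘(ℝ, P) 𝓘(ℝ, E) ∞ f D) (hz : z ∈ D)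
    (hp : f z ∈ (chartAt E p).source) : ∀ᶠ z' in 𝓝[D] z, f z' ∈ (chartAt E p).source :=
  (hf z hz).continuousWithinAt.eventually ((chartAt E p).open_source.mem_nhds hp)

theorem contDiffWithinAt_coord {p : M} (hf : ContMDiffOn 𝓘(ℝ, P) 𝓘(ℝ, E) ∞ f D) (hz : z ∈ D)
    (hp : f z ∈ (chartAt E p).source) :
    ContDiffWithinAt ℝ ∞ (fun z' ↦ extChartAt 𝓘(ℝ, E) p (f z')) D z :=
  contDiffWithinAt_extChartAt_comp hp (hf z hz)

theorem toChart_dirVel {p : M} (hf : ContMDiffOn 𝓘(ℝ, P) 𝓘(ℝ, E) ∞ f D) (hD : UniqueDiffOn ℝ D)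
    (hz : z ∈ D) (hp : f z ∈ (chartAt E p).source) :
    toChart p (f z) (dirVel (E := E) f D e z)
      = fderivWithin ℝ (fun z' ↦ extChartAt 𝓘(ℝ, E) p (f z')) D z e :=
  toChart_mfderivWithin hp ((hf z hz).mdifferentiableWithinAt (by simp)) (hD z hz) e

theorem smoothAlong_dirVel (hf : ContMDiffOn 𝓘(ℝ, P) 𝓘(ℝ, E) ∞ f D) (hD : UniqueDiffOn ℝ D) :
    SmoothAlong f D (dirVel (E := E) f D e) := by
  intro z hz p hp
  have h := ((contDiffWithinAt_coord hf hz hp).fderivWithin_right (m := ∞) hD (by simp)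
    hz).clm_apply (contDiffWithinAt_const (c := e))
  refine h.congr_of_eventuallyEq ?_ (toChart_dirVel hf hD hz hp)
  filter_upwards [eventually_mem_chart_source hf hz hp, self_mem_nhdsWithin] with z' hp' hz'
  exact toChart_dirVel hf hD hz' hp'

theorem SmoothAlong.mono (hW : SmoothAlong f D W) (h : D' ⊆ D) : SmoothAlong f D' W :=
  fun z hz p hp ↦ (hW z (h hz) p hp).mono h

theorem SmoothAlong.congr (hW : SmoothAlong f D W) (h : ∀ z ∈ D, Z z = W z) :
    SmoothAlong f D Z := fun z hz p hp ↦
  (hW z hz p hp).congr (fun z' hz' ↦ by rw [h z' hz']) (by rw [h z hz])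

theorem SmoothAlong.comp {ℓ : Q → P} {C : Set Q} (hW : SmoothAlong f D W)
    (hℓ : ContDiffOn ℝ ∞ ℓ C) (h : MapsTo ℓ C D) :
    SmoothAlong (f ∘ ℓ) C (fun s ↦ W (ℓ s)) := fun s hs p hp ↦
  (hW (ℓ s) (h hs) p hp).comp s (hℓ s hs) h

omit [IsManifold 𝓘(ℝ, E) ∞ M] in
theorem dirVel_comp {ℓ : Q → P} {C : Set Q} {s v : Q} {L : Q →L[ℝ] P}
    (hf : MDifferentiableWithinAt 𝓘(ℝ, P) 𝓘(ℝ, E) f D (ℓ s))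
    (hC : UniqueDiffWithinAt ℝ C s) (hℓ : HasFDerivWithinAt ℓ L C s) (h : MapsTo ℓ C D) :
    dirVel (E := E) (f ∘ ℓ) C v s = dirVel f D (L v) (ℓ s) := by
  rw [dirVel, mfderivWithin_comp s hf hℓ.differentiableWithinAt.mdifferentiableWithinAt h
    hC.uniqueMDiffWithinAt, mfderivWithin_eq_fderivWithin, hℓ.fderivWithin hC]
  rfl

omit [IsManifold 𝓘(ℝ, E) ∞ M] in
theorem dirVel_congr_set (h : D =ᶠ[𝓝 z] D') :
    dirVel (E := E) f D e z = dirVel f D' e z := by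
  rw [dirVel, mfderivWithin_congr_set h]; rfl

theorem fderivWithin_clm_comp_apply {Q A B : Type*} [NormedAddCommGroup Q] [NormedSpace ℝ Q]
    [NormedAddCommGroup A] [NormedSpace ℝ A] [NormedAddCommGroup B] [NormedSpace ℝ B]
    {f : Q → A →L[ℝ] B} {φ : P → Q} {u : P → A} (hD : UniqueDiffWithinAt ℝ D z)
    (hf : DifferentiableAt ℝ f (φ z)) (hφ : DifferentiableWithinAt ℝ φ D z)
    (hu : DifferentiableWithinAt ℝ u D z) (e : P) :
    fderivWithin ℝ (fun z ↦ f (φ z) (u z)) D z e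
      = fderiv ℝ f (φ z) (fderivWithin ℝ φ D z e) (u z) + f (φ z) (fderivWithin ℝ u D z e) := by
  rw [((hasFDerivWithinAt_comp_fderiv hf hφ).clm_apply hu.hasFDerivWithinAt).fderivWithin hD]
  simp only [add_apply, ContinuousLinearMap.flip_apply, ContinuousLinearMap.comp_apply]
  abel

variable [RiemannianBundle (fun q : M ↦ TangentSpace 𝓘(ℝ, E) q)]

/-- The covariant derivative in the direction `e` of a vector field `W` along a map `f : P → M` with
domain `D` in a vector space `P`, computed in the chart at `f z`. For `P = ℝ` and `e = 1` this is
`covDeriv`. -/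
def covAlong (f : P → M) (D : Set P) (e : P) (W : (z : P) → TangentSpace 𝓘(ℝ, E) (f z)) (z : P) :
    TangentSpace 𝓘(ℝ, E) (f z) :=
  ofChart (f z) (f z)
    (fderivWithin ℝ (fun z' ↦ toChart (f z) (f z') (W z')) D z e
      + christoffel (f z) (extChartAt 𝓘(ℝ, E) (f z) (f z))
          (toChart (f z) (f z) (dirVel f D e z)) (toChart (f z) (f z) (W z)))

theorem covDeriv_eq_covAlong (s : Set ℝ) (x : ℝ → M) (W : (t : ℝ) → TangentSpace 𝓘(ℝ, E) (x t))
    (t : ℝ) : covDeriv s x W t = covAlong x s 1 W t := rfl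

theorem covAlong_congr_set (h : D =ᶠ[𝓝 z] D') : covAlong f D e W z = covAlong f D' e W z := by
  rw [covAlong, covAlong, fderivWithin_congr_set h, dirVel_congr_set h]

theorem covAlong_congr (h : ∀ᶠ z' in 𝓝[D] z, W z' = Z z') (hz : z ∈ D) :
    covAlong f D e W z = covAlong f D e Z z := by
  have h' : (fun z' ↦ toChart (f z) (f z') (W z')) =ᶠ[𝓝[D] z]
      (fun z' ↦ toChart (f z) (f z') (Z z')) := h.mono fun z' hz' ↦ by simp only [hz']
  rw [covAlong, covAlong, h'.fderivWithin_eq_of_mem hz, h.self_of_nhdsWithin hz]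

variable [FiniteDimensional ℝ E]
  [IsContMDiffRiemannianBundle 𝓘(ℝ, E) ∞ E (fun p : M ↦ TangentSpace 𝓘(ℝ, E) p)]

/-- The coordinate expression of the covariant derivative is the same in all charts. -/
theorem toChart_covAlong {p : M} (hf : ContMDiffOn 𝓘(ℝ, P) 𝓘(ℝ, E) ∞ f D)
    (hD : UniqueDiffOn ℝ D) (hz : z ∈ D) (hp : f z ∈ (chartAt E p).source)
    (hW : DifferentiableWithinAt ℝ (fun z' ↦ toChart p (f z') (W z')) D z) :
    toChart p (f z) (covAlong f D e W z)
      = fderivWithin ℝ (fun z' ↦ toChart p (f z') (W z')) D z e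
        + christoffel p (extChartAt 𝓘(ℝ, E) p (f z))
          (fderivWithin ℝ (fun z' ↦ extChartAt 𝓘(ℝ, E) p (f z')) D z e)
          (toChart p (f z) (W z)) := by
  have hc := mem_chart_source E (f z)
  have hev : (fun z' ↦ toChart (f z) (f z') (W z')) =ᶠ[𝓝[D] z]
      fun z' ↦ fderiv ℝ (transition p (f z)) (extChartAt 𝓘(ℝ, E) p (f z'))
        (toChart p (f z') (W z')) := by
    filter_upwards [eventually_mem_chart_source hf hz hp, eventually_mem_chart_source hf hz hc]
      with z' hp' hc'
    exact toChart_transition hp' hc' _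
  have hτ : DifferentiableAt ℝ (fderiv ℝ (transition p (f z) : E → E))
      (extChartAt 𝓘(ℝ, E) p (f z)) :=
    ((contDiffAt_transition hp hc).fderiv_right (m := ∞) (by simp)).differentiableAt (by simp)
  have ha := (contDiffWithinAt_coord hf hz hp).differentiableWithinAt (by simp)
  have hv : ∀ v : E, ofChart (f z) (f z) (fderiv ℝ (transition p (f z))
      (extChartAt 𝓘(ℝ, E) p (f z)) v) = ofChart p (f z) v := by
    intro v
    rw [← ofChart_toChart hc (ofChart p (f z) v), toChart_transition hp hc, toChart_ofChart hp]
  have hexpr : covAlong f D e W z = ofChart p (f z)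
      (fderivWithin ℝ (fun z' ↦ toChart p (f z') (W z')) D z e
        + christoffel p (extChartAt 𝓘(ℝ, E) p (f z))
          (fderivWithin ℝ (fun z' ↦ extChartAt 𝓘(ℝ, E) p (f z')) D z e)
          (toChart p (f z) (W z))) := by
    rw [← hv, covAlong, hev.fderivWithin_eq_of_mem hz,
      fderivWithin_clm_comp_apply (hD z hz) hτ ha hW, map_add (fderiv ℝ _ _),
      christoffel_transition hp hc, toChart_transition hp hc, toChart_transition hp hc,
      toChart_dirVel hf hD hz hp]
    congr 1
    abel
  rw [hexpr, toChart_ofChart hp]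

theorem contDiffWithinAt_christoffelL_coord {p : M} (hf : ContMDiffOn 𝓘(ℝ, P) 𝓘(ℝ, E) ∞ f D)
    (hz : z ∈ D) (hp : f z ∈ (chartAt E p).source) :
    ContDiffWithinAt ℝ ∞ (fun z' ↦ localChristoffelL (metricInChart p)
      (extChartAt 𝓘(ℝ, E) p (f z'))) D z :=
  ContDiffAt.comp_contDiffWithinAt (g := localChristoffelL (metricInChart p)) z
    (isMetricAt_metricInChart hp).contDiffAt_localChristoffelL (contDiffWithinAt_coord hf hz hp)

theorem SmoothAlong.covAlong (hW : SmoothAlong f D W) (hf : ContMDiffOn 𝓘(ℝ, P) 𝓘(ℝ, E) ∞ f D)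
    (hD : UniqueDiffOn ℝ D) : SmoothAlong f D (covAlong f D e W) := by
  intro z hz p hp
  have h1 := ((hW z hz p hp).fderivWithin_right (m := ∞) hD (by simp) hz).clm_apply
    (contDiffWithinAt_const (c := e))
  have h2 := ((contDiffWithinAt_coord hf hz hp).fderivWithin_right (m := ∞) hD (by simp)
    hz).clm_apply (contDiffWithinAt_const (c := e))
  have h3 := ((contDiffWithinAt_christoffelL_coord hf hz hp).clm_apply h2).clm_apply
    (hW z hz p hp)
  refine (h1.add h3).congr_of_eventuallyEq ?_
    (toChart_covAlong hf hD hz hp (hW.differentiableWithinAt hz hp))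
  filter_upwards [eventually_mem_chart_source hf hz hp, self_mem_nhdsWithin] with z' hp' hz'
  exact toChart_covAlong hf hD hz' hp' (hW.differentiableWithinAt hz' hp')

omit [FiniteDimensional ℝ E]
  [IsContMDiffRiemannianBundle 𝓘(ℝ, E) ∞ E fun p : M ↦ TangentSpace 𝓘(ℝ, E) p] in
/-- Covariant derivatives along `f` restrict to covariant derivatives along `f ∘ ℓ`. -/
theorem covAlong_comp {ℓ : Q → P} {C : Set Q} {s v : Q} {L : Q →L[ℝ] P} (hW : SmoothAlong f D W)
    (hf : ContMDiffOn 𝓘(ℝ, P) 𝓘(ℝ, E) ∞ f D)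
    (hC : UniqueDiffWithinAt ℝ C s) (hs : s ∈ C) (hℓ : HasFDerivWithinAt ℓ L C s)
    (h : MapsTo ℓ C D) :
    covAlong (f ∘ ℓ) C v (fun s ↦ W (ℓ s)) s = covAlong f D (L v) W (ℓ s) := by
  have hz := h hs
  have hc := mem_chart_source E (f (ℓ s))
  have h1 : fderivWithin ℝ (fun s' ↦ toChart (f (ℓ s)) (f (ℓ s')) (W (ℓ s'))) C s v
      = fderivWithin ℝ (fun z' ↦ toChart (f (ℓ s)) (f z') (W z')) D (ℓ s) (L v) := by
    have := (hW.differentiableWithinAt hz hc).hasFDerivWithinAt.comp s hℓ h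
    exact DFunLike.congr_fun (this.fderivWithin hC) v
  have h2 := dirVel_comp (v := v) ((hf _ hz).mdifferentiableWithinAt (by simp)) hC hℓ h
  rw [covAlong, covAlong, h2]
  simp only [Function.comp]
  rw [h1]

theorem SmoothAlong.contDiffOn_inner (hW : SmoothAlong f D W) (hZ : SmoothAlong f D Z)
    (hf : ContMDiffOn 𝓘(ℝ, P) 𝓘(ℝ, E) ∞ f D) :
    ContDiffOn ℝ ∞ (fun z ↦ (inner ℝ (W z) (Z z) : ℝ)) D := by
  intro z hz
  have hc := mem_chart_source E (f z)
  have h1 := (((isMetricAt_metricInChart hc).contDiffAt.comp_contDiffWithinAt z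
    (contDiffWithinAt_coord hf hz hc)).clm_apply (hW z hz _ hc)).clm_apply (hZ z hz _ hc)
  refine h1.congr_of_eventuallyEq ?_ (inner_eq_metricInChart hc _ _)
  filter_upwards [eventually_mem_chart_source hf hz hc] with z' hc'
  exact inner_eq_metricInChart hc' _ _

/-- The covariant derivative is compatible with the metric. -/
theorem fderivWithin_inner_eq (hW : SmoothAlong f D W) (hZ : SmoothAlong f D Z)
    (hf : ContMDiffOn 𝓘(ℝ, P) 𝓘(ℝ, E) ∞ f D) (hD : UniqueDiffOn ℝ D) (hz : z ∈ D) :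
    fderivWithin ℝ (fun z ↦ (inner ℝ (W z) (Z z) : ℝ)) D z e
      = inner ℝ (covAlong f D e W z) (Z z) + inner ℝ (W z) (covAlong f D e Z z) := by
  have hc := mem_chart_source E (f z)
  have hev : (fun z ↦ (inner ℝ (W z) (Z z) : ℝ)) =ᶠ[𝓝[D] z] fun z' ↦
      metricInChart (f z) (extChartAt 𝓘(ℝ, E) (f z) (f z')) (toChart (f z) (f z') (W z'))
        (toChart (f z) (f z') (Z z')) := by
    filter_upwards [eventually_mem_chart_source hf hz hc] with z' hc'
    exact inner_eq_metricInChart hc' _ _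
  have hm := isMetricAt_metricInChart hc
  have hw := hW.differentiableWithinAt hz hc
  have hz' := hZ.differentiableWithinAt hz hc
  rw [hev.fderivWithin_eq_of_mem hz, fderivWithin_bilinear_apply (hD z hz) hm.differentiableAt
    ((contDiffWithinAt_coord hf hz hc).differentiableWithinAt (by simp)) hw hz',
    inner_eq_metricInChart hc, inner_eq_metricInChart hc, toChart_covAlong hf hD hz hc hw,
    toChart_covAlong hf hD hz hc hz', hm.fderiv_apply]
  simp only [map_add, add_apply, christoffel_eq]
  ring

/-- Symmetry of second derivatives within `D`, at points that are limits of interior points. -/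
theorem fderivWithin_fderivWithin_symm {A : Type*} [NormedAddCommGroup A] [NormedSpace ℝ A]
    {a : P → A} (ha : ContDiffWithinAt ℝ ∞ a D z) (hD : UniqueDiffOn ℝ D) (hz : z ∈ D)
    (hz' : z ∈ closure (interior D)) (u v : P) :
    fderivWithin ℝ (fun z ↦ fderivWithin ℝ a D z v) D z u
      = fderivWithin ℝ (fun z ↦ fderivWithin ℝ a D z u) D z v := by
  have hd : DifferentiableWithinAt ℝ (fderivWithin ℝ a D) D z :=
    (ha.fderivWithin_right (m := ∞) hD (by simp) hz).differentiableWithinAt (by simp)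
  have hs : IsSymmSndFDerivWithinAt ℝ a D z := ha.isSymmSndFDerivWithinAt
    (by rw [minSmoothness_of_isRCLikeNormedField]; exact WithTop.coe_le_coe.2 le_top) hD hz' hz
  have h : ∀ u v : P, fderivWithin ℝ (fun z ↦ fderivWithin ℝ a D z v) D z u
      = fderivWithin ℝ (fderivWithin ℝ a D) D z u v := by
    intro u v
    rw [(hd.hasFDerivWithinAt.clm_apply (hasFDerivWithinAt_const v z D)).fderivWithin (hD z hz)]
    simp
  rw [h, h, hs u v]

/-- The covariant derivative of `∂f/∂e₂` in the direction `e₁` is symmetric in `e₁` and `e₂`: the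
connection is torsion free. -/
theorem covAlong_dirVel_comm (hf : ContMDiffOn 𝓘(ℝ, P) 𝓘(ℝ, E) ∞ f D) (hD : UniqueDiffOn ℝ D)
    (hz : z ∈ D) (hz' : z ∈ closure (interior D)) :
    covAlong (E := E) f D e₁ (dirVel f D e₂) z = covAlong f D e₂ (dirVel f D e₁) z := by
  have hc := mem_chart_source E (f z)
  have hev : ∀ e : P, (fun z' ↦ toChart (f z) (f z') (dirVel (E := E) f D e z')) =ᶠ[𝓝[D] z] fun z' ↦
      fderivWithin ℝ (fun z' ↦ extChartAt 𝓘(ℝ, E) (f z) (f z')) D z' e := by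
    intro e
    filter_upwards [eventually_mem_chart_source hf hz hc, self_mem_nhdsWithin] with z' hc' hz'
    exact toChart_dirVel hf hD hz' hc'
  apply toChart_injective hc
  rw [toChart_covAlong hf hD hz hc ((smoothAlong_dirVel hf hD).differentiableWithinAt hz hc),
    toChart_covAlong hf hD hz hc ((smoothAlong_dirVel hf hD).differentiableWithinAt hz hc),
    (hev e₁).fderivWithin_eq_of_mem hz, (hev e₂).fderivWithin_eq_of_mem hz,
    fderivWithin_fderivWithin_symm (contDiffWithinAt_coord hf hz hc) hD hz hz',
    toChart_dirVel hf hD hz hc, toChart_dirVel hf hD hz hc, christoffel_eq, christoffel_eq,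
    (isMetricAt_metricInChart hc).localChristoffel_symm]

/-- The commutator of covariant derivatives is the curvature. -/
theorem covAlong_covAlong_sub (hW : SmoothAlong f D W) (hf : ContMDiffOn 𝓘(ℝ, P) 𝓘(ℝ, E) ∞ f D)
    (hD : UniqueDiffOn ℝ D) (hz : z ∈ D) (hz' : z ∈ closure (interior D)) :
    covAlong f D e₁ (covAlong f D e₂ W) z - covAlong f D e₂ (covAlong f D e₁ W) z
      = curvature (f z) (dirVel f D e₁ z) (dirVel f D e₂ z) (W z) := by
  have hc := mem_chart_source E (f z)
  have hm := isMetricAt_metricInChart hc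
  set c : M := f z with hcdef
  set a : P → E := fun z' ↦ extChartAt 𝓘(ℝ, E) c (f z') with ha_def
  set w : P → E := fun z' ↦ toChart c (f z') (W z') with hw_def
  set G := localChristoffelL (metricInChart (E := E) c) with hG
  have ha := contDiffWithinAt_coord hf hz hc
  have hw := hW z hz c hc
  have ha1 : ∀ e, DifferentiableWithinAt ℝ (fun z' ↦ fderivWithin ℝ a D z' e) D z := fun e ↦
    ((ha.fderivWithin_right (m := ∞) hD (by simp) hz).clm_apply
      (contDiffWithinAt_const (c := e))).differentiableWithinAt (by simp)
  have hw1 : ∀ e, DifferentiableWithinAt ℝ (fun z' ↦ fderivWithin ℝ w D z' e) D z := fun e ↦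
    ((hw.fderivWithin_right (m := ∞) hD (by simp) hz).clm_apply
      (contDiffWithinAt_const (c := e))).differentiableWithinAt (by simp)
  have ha0 : DifferentiableWithinAt ℝ a D z := ha.differentiableWithinAt (by simp)
  have hw0 : DifferentiableWithinAt ℝ w D z := hw.differentiableWithinAt (by simp)
  have hGd : DifferentiableAt ℝ G (a z) :=
    hm.contDiffAt_localChristoffelL.differentiableAt (by simp)
  have hev : ∀ e : P, (fun z' ↦ toChart c (f z') (covAlong (E := E) f D e W z')) =ᶠ[𝓝[D] z] fun z' ↦
      fderivWithin ℝ w D z' e + G (a z') (fderivWithin ℝ a D z' e) (w z') := by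
    intro e
    filter_upwards [eventually_mem_chart_source hf hz hc, self_mem_nhdsWithin] with z' hc' hz'
    exact toChart_covAlong hf hD hz' hc' (hW.differentiableWithinAt hz' hc')
  -- the components of an iterated covariant derivative; antisymmetrizing in `e` and `e'` removes the
  -- second derivatives of `a` and `w` and leaves the curvature
  have hexp : ∀ e e', toChart c (f z) (covAlong (E := E) f D e (covAlong f D e' W) z)
      = fderivWithin ℝ (fun z' ↦ fderivWithin ℝ w D z' e') D z e
        + (fderiv ℝ G (a z) (fderivWithin ℝ a D z e) (fderivWithin ℝ a D z e') (w z)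
          + G (a z) (fderivWithin ℝ (fun z' ↦ fderivWithin ℝ a D z' e') D z e) (w z)
          + G (a z) (fderivWithin ℝ a D z e') (fderivWithin ℝ w D z e))
        + G (a z) (fderivWithin ℝ a D z e)
          (fderivWithin ℝ w D z e' + G (a z) (fderivWithin ℝ a D z e') (w z)) := by
    intro e e'
    rw [toChart_covAlong hf hD hz hc ((hW.covAlong hf hD).differentiableWithinAt hz hc),
      (hev e').fderivWithin_eq_of_mem hz,
      show toChart c (f z) (covAlong (E := E) f D e' W z) = _ from (hev e').self_of_nhdsWithin hz]
    have hg1 : DifferentiableWithinAt ℝ (fun z' ↦ G (a z') (fderivWithin ℝ a D z' e') (w z')) D z :=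
      ((hasFDerivWithinAt_comp_fderiv hGd ha0).differentiableWithinAt.clm_apply (ha1 e')).clm_apply
        hw0
    rw [fderivWithin_fun_add (hD z hz) (hw1 e') hg1, add_apply,
      fderivWithin_bilinear_apply (hD z hz) hGd ha0 (ha1 e') hw0]
    rfl
  have hGc : ∀ u v v', fderiv ℝ (fun y ↦ localChristoffel (metricInChart c) y v v') (a z) u
      = fderiv ℝ G (a z) u v v' := fun u v v' ↦ fderiv_bilinear_const hGd v v' u
  apply toChart_injective hc
  rw [map_sub, hexp, hexp, curvature_eq, toChart_ofChart hc, toChart_dirVel hf hD hz hc,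
    toChart_dirVel hf hD hz hc, localCurvature]
  change _ = fderiv ℝ (fun y ↦ localChristoffel (metricInChart c) y _ _) (a z) _
    - fderiv ℝ (fun y ↦ localChristoffel (metricInChart c) y _ _) (a z) _ + _ - _
  rw [hGc, hGc, fderivWithin_fderivWithin_symm hw hD hz hz' e₁ e₂,
    fderivWithin_fderivWithin_symm ha hD hz hz' e₁ e₂, map_add, map_add]
  simp only [hG, localChristoffelL_apply]
  change _ = fderiv ℝ G (a z) (fderivWithin ℝ a D z e₁) (fderivWithin ℝ a D z e₂) (w z)
    - fderiv ℝ G (a z) (fderivWithin ℝ a D z e₂) (fderivWithin ℝ a D z e₁) (w z)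
    + localChristoffel (metricInChart c) (a z) (fderivWithin ℝ a D z e₁)
      (localChristoffel (metricInChart c) (a z) (fderivWithin ℝ a D z e₂) (w z))
    - localChristoffel (metricInChart c) (a z) (fderivWithin ℝ a D z e₂)
      (localChristoffel (metricInChart c) (a z) (fderivWithin ℝ a D z e₁) (w z))
  simp only [hG]
  abel

end Fields

/-! ### Partitions of an interval -/

section Partitions

namespace IsPartition

variable {T : ℝ} {l : ℕ} {t : Fin (l + 1) → ℝ}

theorem lt (ht : IsPartition T t) (j : Fin l) : t j.castSucc < t j.succ :=
  ht.strictMono (Fin.castSucc_lt_succ)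

theorem mem_Icc (ht : IsPartition T t) (k : Fin (l + 1)) : t k ∈ Icc 0 T := by
  rw [← ht.zero, ← ht.last]
  exact ⟨ht.strictMono.monotone (Fin.zero_le k), ht.strictMono.monotone (Fin.le_last k)⟩

theorem Icc_subset (ht : IsPartition T t) (j : Fin l) :
    Icc (t j.castSucc) (t j.succ) ⊆ Icc 0 T :=
  Icc_subset_Icc (ht.mem_Icc _).1 (ht.mem_Icc _).2

theorem exists_mem_Ioc (ht : IsPartition T t) {s : ℝ} (hs : s ∈ Ioc 0 T) :
    ∃ j : Fin l, s ∈ Ioc (t j.castSucc) (t j.succ) := by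
  by_contra! h
  have : ∀ k : Fin (l + 1), t k < s := by
    intro k
    induction k using Fin.induction with
    | zero => rw [ht.zero]; exact hs.1
    | succ j ih =>
      by_contra! hj
      exact h j ⟨ih, hj⟩
  have h' := this (Fin.last l)
  rw [ht.last] at h'
  exact absurd hs.2 (not_le.2 h')

theorem exists_mem_Ioo (ht : IsPartition T t) {s : ℝ} (hs : s ∈ Ioo 0 T) (hs' : s ∉ range t) :
    ∃ j : Fin l, s ∈ Ioo (t j.castSucc) (t j.succ) := by
  obtain ⟨j, hj⟩ := ht.exists_mem_Ioc ⟨hs.1, hs.2.le⟩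
  exact ⟨j, hj.1, lt_of_le_of_ne hj.2 fun h ↦ hs' ⟨_, h.symm⟩⟩

theorem exists_mem_Icc (ht : IsPartition T t) (hT : 0 < T) {s : ℝ} (hs : s ∈ Icc 0 T) :
    ∃ j : Fin l, s ∈ Icc (t j.castSucc) (t j.succ) := by
  rcases hs.1.eq_or_lt with h0 | h0
  · obtain ⟨j, hj⟩ := ht.exists_mem_Ioc ⟨hT, le_rfl⟩
    have hl : 0 < l := j.pos
    refine ⟨⟨0, hl⟩, ?_⟩
    have h1 : t (⟨0, hl⟩ : Fin l).castSucc = s := by rw [← h0]; exact ht.zero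
    exact ⟨h1.le, h1 ▸ (ht.lt _).le⟩
  · obtain ⟨j, hj⟩ := ht.exists_mem_Ioc ⟨h0, hs.2⟩
    exact ⟨j, Ioc_subset_Icc_self hj⟩

/-- The points of a partition as a sequence that is eventually constant. -/
theorem exists_seq (ht : IsPartition T t) : ∃ a : ℕ → ℝ, a 0 = 0 ∧ a l = T ∧
    ∀ j : Fin l, a j = t j.castSucc ∧ a (j + 1) = t j.succ := by
  refine ⟨fun k ↦ if h : k < l + 1 then t ⟨k, h⟩ else T, ?_, ?_, fun j ↦ ⟨?_, ?_⟩⟩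
  · simpa using ht.zero
  · simp only [lt_add_iff_pos_right, zero_lt_one, dif_pos]; exact ht.last
  · simp only; rw [dif_pos (by omega)]; rfl
  · simp only; rw [dif_pos (by omega)]; rfl

theorem intervalIntegrable (ht : IsPartition T t) {f : ℝ → ℝ}
    (hf : ∀ j : Fin l, IntervalIntegrable f volume (t j.castSucc) (t j.succ)) :
    IntervalIntegrable f volume 0 T := by
  obtain ⟨a, h0, h1, ha⟩ := ht.exists_seq
  rw [← h0, ← h1]
  refine IntervalIntegrable.trans_iterate fun k hk ↦ ?_
  have := ha ⟨k, hk⟩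
  rw [this.1, this.2]
  exact hf _

theorem sum_integral (ht : IsPartition T t) {f : ℝ → ℝ}
    (hf : ∀ j : Fin l, IntervalIntegrable f volume (t j.castSucc) (t j.succ)) :
    ∑ j : Fin l, ∫ s in t j.castSucc..t j.succ, f s = ∫ s in (0 : ℝ)..T, f s := by
  obtain ⟨a, h0, h1, ha⟩ := ht.exists_seq
  have := intervalIntegral.sum_integral_adjacent_intervals (f := f) (μ := volume) (a := a) (n := l)
    fun k hk ↦ by rw [(ha ⟨k, hk⟩).1, (ha ⟨k, hk⟩).2]; exact hf _
  rw [← h0, ← h1, ← this, Finset.sum_range]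
  exact Finset.sum_congr rfl fun j _ ↦ by rw [(ha j).1, (ha j).2]

theorem intervalIntegrable_piece (ht : IsPartition T t) {f : ℝ → ℝ}
    (hf : IntervalIntegrable f volume 0 T) (j : Fin l) :
    IntervalIntegrable f volume (t j.castSucc) (t j.succ) := by
  refine hf.mono_set ?_
  rw [uIcc_of_le (ht.lt j).le, uIcc_of_le ((ht.mem_Icc 0).1.trans (ht.mem_Icc 0).2)]
  exact ht.Icc_subset j

end IsPartition

end Partitions

/-! ### Integrals of piecewise smooth functions -/

section Integrals

/-- Differentiation under the integral sign for a function which is `C^1` on a strip. -/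
theorem hasDerivAt_integral_strip {δ a b : ℝ} (hδ : 0 < δ) (hab : a < b) {G : ℝ × ℝ → ℝ}
    (hG : ContDiffOn ℝ 1 G (Ioo (-δ) δ ×ˢ Icc a b)) :
    (∀ r ∈ Ioo (-δ) δ, IntervalIntegrable (fun s ↦ G (r, s)) volume a b) ∧
    IntervalIntegrable (fun s ↦ deriv (fun r ↦ G (r, s)) 0) volume a b ∧
    HasDerivAt (fun r ↦ ∫ s in a..b, G (r, s)) (∫ s in a..b, deriv (fun r ↦ G (r, s)) 0) 0 := by
  set D := Ioo (-δ) δ ×ˢ Icc a b with hDdef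
  have hD : UniqueDiffOn ℝ D := (uniqueDiffOn_Ioo _ _).prod (uniqueDiffOn_Icc hab)
  have hF' : ContinuousOn (fun z ↦ fderivWithin ℝ G D z (1, 0)) D :=
    (hG.continuousOn_fderivWithin hD le_rfl).clm_apply continuousOn_const
  have hline : ∀ r ∈ Ioo (-δ) δ, ContinuousOn (fun s : ℝ ↦ ((r, s) : ℝ × ℝ)) (Icc a b) ∧
      MapsTo (fun s : ℝ ↦ ((r, s) : ℝ × ℝ)) (Icc a b) D := fun r hr ↦
    ⟨by fun_prop, fun s hs ↦ mk_mem_prod hr hs⟩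
  have hint : ∀ r ∈ Ioo (-δ) δ, IntervalIntegrable (fun s ↦ G (r, s)) volume a b := fun r hr ↦
    (hG.continuousOn.comp (hline r hr).1 (hline r hr).2).intervalIntegrable_of_Icc hab.le
  have hd : ∀ r ∈ Ioo (-δ) δ, ∀ s ∈ Icc a b,
      HasDerivAt (fun r ↦ G (r, s)) (fderivWithin ℝ G D (r, s) (1, 0)) r := by
    intro r hr s hs
    have h1 : HasFDerivWithinAt G (fderivWithin ℝ G D (r, s)) D (r, s) :=
      ((hG.differentiableOn one_ne_zero) (r, s) (mk_mem_prod hr hs)).hasFDerivWithinAt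
    have h2 : HasDerivWithinAt (fun r : ℝ ↦ ((r, s) : ℝ × ℝ)) (1, 0) (Ioo (-δ) δ) r :=
      ((hasDerivAt_id r).prodMk (hasDerivAt_const r s)).hasDerivWithinAt
    exact (h1.comp_hasDerivWithinAt r h2 fun r1 hr1 ↦ mk_mem_prod hr1 hs).hasDerivAt
      (isOpen_Ioo.mem_nhds hr)
  have h0 : (0 : ℝ) ∈ Ioo (-δ) δ := ⟨by linarith, hδ⟩
  have hsub : Icc (-(δ / 2)) (δ / 2) ×ˢ Icc a b ⊆ D :=
    prod_mono (Icc_subset_Ioo (by linarith) (by linarith)) subset_rfl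
  obtain ⟨C, hC⟩ := (isCompact_Icc.prod isCompact_Icc).exists_bound_of_continuousOn
    (hF'.mono hsub)
  have hF'0 : IntervalIntegrable (fun s ↦ fderivWithin ℝ G D (0, s) (1, 0)) volume a b :=
    (hF'.comp (hline 0 h0).1 (hline 0 h0).2).intervalIntegrable_of_Icc hab.le
  have key := intervalIntegral.hasDerivAt_integral_of_dominated_loc_of_deriv_le
    (F := fun r s ↦ G (r, s)) (F' := fun r s ↦ fderivWithin ℝ G D (r, s) (1, 0)) (μ := volume)
    (x₀ := (0 : ℝ)) (s := Icc (-(δ / 2)) (δ / 2)) (a := a) (b := b) (bound := fun _ ↦ C)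
    (Icc_mem_nhds (by linarith) (by linarith))
    (by
      filter_upwards [isOpen_Ioo.mem_nhds h0] with r hr
      exact IntervalIntegrable.aestronglyMeasurable_restrict_uIoc (hint r hr))
    (hint 0 h0) (IntervalIntegrable.aestronglyMeasurable_restrict_uIoc hF'0)
    (Eventually.of_forall fun s hs r hr ↦ hC (r, s) ⟨hr, by
      rw [uIoc_of_le hab.le] at hs; exact Ioc_subset_Icc_self hs⟩)
    intervalIntegrable_const
    (Eventually.of_forall fun s hs r hr ↦ hd r
      (Icc_subset_Ioo (by linarith) (by linarith) hr) s (by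
        rw [uIoc_of_le hab.le] at hs; exact Ioc_subset_Icc_self hs))
  have hcongr : EqOn (fun s ↦ fderivWithin ℝ G D (0, s) (1, 0))
      (fun s ↦ deriv (fun r ↦ G (r, s)) 0) (uIoo a b) := by
    intro s hs
    rw [uIoo_of_le hab.le] at hs
    exact ((hd 0 h0 s (Ioo_subset_Icc_self hs)).deriv).symm
  refine ⟨hint, key.1.congr_uIoo hcongr, ?_⟩
  rw [← intervalIntegral.integral_congr_uIoo hcongr]
  exact key.2

/-- Differentiation under the integral sign for a function which is `C^1` on the strips over a
partition. At the break points its values are arbitrary. -/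
theorem IsPartition.hasDerivAt_integral {T δ : ℝ} {l : ℕ} {t : Fin (l + 1) → ℝ}
    (ht : IsPartition T t) (hδ : 0 < δ) {F : ℝ → ℝ → ℝ}
    (hF : ∀ j : Fin l, ∃ G : ℝ × ℝ → ℝ,
      ContDiffOn ℝ 1 G (Ioo (-δ) δ ×ˢ Icc (t j.castSucc) (t j.succ)) ∧
      ∀ r ∈ Ioo (-δ) δ, ∀ s ∈ Ioo (t j.castSucc) (t j.succ), F r s = G (r, s)) :
    (∀ r ∈ Ioo (-δ) δ, IntervalIntegrable (F r) volume 0 T) ∧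
    IntervalIntegrable (fun s ↦ deriv (fun r ↦ F r s) 0) volume 0 T ∧
    HasDerivAt (fun r ↦ ∫ s in (0 : ℝ)..T, F r s)
      (∫ s in (0 : ℝ)..T, deriv (fun r ↦ F r s) 0) 0 := by
  choose G hG hFG using hF
  have h0 : Ioo (-δ) δ ∈ 𝓝 (0 : ℝ) := Ioo_mem_nhds (by linarith) hδ
  have key := fun j ↦ hasDerivAt_integral_strip hδ (ht.lt j) (hG j)
  have hcongr : ∀ j : Fin l, ∀ r ∈ Ioo (-δ) δ, EqOn (fun s ↦ G j (r, s)) (F r)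
      (uIoo (t j.castSucc) (t j.succ)) := by
    intro j r hr s hs
    rw [uIoo_of_le (ht.lt j).le] at hs
    exact (hFG j r hr s hs).symm
  have hcongr' : ∀ j : Fin l, EqOn (fun s ↦ deriv (fun r ↦ G j (r, s)) 0)
      (fun s ↦ deriv (fun r ↦ F r s) 0) (uIoo (t j.castSucc) (t j.succ)) := by
    intro j s hs
    rw [uIoo_of_le (ht.lt j).le] at hs
    refine EventuallyEq.deriv_eq ?_
    filter_upwards [h0] with r hr
    exact (hFG j r hr s hs).symm
  have hint : ∀ r ∈ Ioo (-δ) δ, ∀ j : Fin l,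
      IntervalIntegrable (F r) volume (t j.castSucc) (t j.succ) :=
    fun r hr j ↦ ((key j).1 r hr).congr_uIoo (hcongr j r hr)
  have hint' : ∀ j : Fin l, IntervalIntegrable (fun s ↦ deriv (fun r ↦ F r s) 0) volume
      (t j.castSucc) (t j.succ) := fun j ↦ (key j).2.1.congr_uIoo (hcongr' j)
  refine ⟨fun r hr ↦ ht.intervalIntegrable (hint r hr), ht.intervalIntegrable hint', ?_⟩
  rw [← ht.sum_integral hint']
  have hsum := HasDerivAt.fun_sum (u := Finset.univ) fun j _ ↦ (key j).2.2
  have hsum' : (∑ j : Fin l, ∫ s in t j.castSucc..t j.succ, deriv (fun r ↦ F r s) 0)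
      = ∑ j : Fin l, ∫ s in t j.castSucc..t j.succ, deriv (fun r ↦ G j (r, s)) 0 :=
    Finset.sum_congr rfl fun j _ ↦ (intervalIntegral.integral_congr_uIoo (hcongr' j)).symm
  rw [hsum']
  refine hsum.congr_of_eventuallyEq ?_
  filter_upwards [h0] with r hr
  rw [← ht.sum_integral (hint r hr)]
  exact Finset.sum_congr rfl fun j _ ↦ (intervalIntegral.integral_congr_uIoo (hcongr j r hr)).symm

theorem eventually_notMem_of_finite {S : Set ℝ} (hS : S.Finite) (c : ℝ) :
    ∀ᶠ s in 𝓝[≠] c, s ∉ S := by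
  have h : (S \ {c})ᶜ ∈ 𝓝 c := (hS.subset sdiff_subset).isClosed.isOpen_compl.mem_nhds (by simp)
  filter_upwards [nhdsWithin_le_nhds h, self_mem_nhdsWithin] with s hs hsc hsS
  exact hs ⟨hsS, hsc⟩

/-- The fundamental theorem of calculus for a function `b` which agrees off a finite set with
functions that are continuous on the closed pieces of a partition. -/
theorem IsPartition.integral_eq_sum_jumps {T : ℝ} {l : ℕ} {t : Fin (l + 1) → ℝ}
    (ht : IsPartition T t) {S : Set ℝ} (hS : S.Finite) {b b' : ℝ → ℝ}
    (hb : ∀ j : Fin l, ∃ B : ℝ → ℝ, ContinuousOn B (Icc (t j.castSucc) (t j.succ)) ∧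
      ∀ s ∈ Ioo (t j.castSucc) (t j.succ) \ S, b s = B s)
    (hd : ∀ s ∈ Ioo 0 T \ S, HasDerivAt b (b' s) s)
    (hi : IntervalIntegrable b' volume 0 T) :
    ∃ bLeft bRight : Fin l → ℝ,
      (∀ j, Tendsto b (𝓝[<] (t j.succ)) (𝓝 (bLeft j))) ∧
      (∀ j, Tendsto b (𝓝[>] (t j.castSucc)) (𝓝 (bRight j))) ∧
      ∫ s in (0 : ℝ)..T, b' s = ∑ j, (bLeft j - bRight j) := by
  choose B hB hbB using hb
  refine ⟨fun j ↦ B j (t j.succ), fun j ↦ B j (t j.castSucc), fun j ↦ ?_, fun j ↦ ?_, ?_⟩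
  · have h1 : Tendsto (B j) (𝓝[Icc (t j.castSucc) (t j.succ)] (t j.succ)) (𝓝 (B j (t j.succ))) :=
      hB j _ (right_mem_Icc.2 (ht.lt j).le)
    have hS' : ∀ᶠ s in 𝓝[<] (t j.succ), s ∉ S :=
      (eventually_notMem_of_finite hS _).filter_mono (nhdsWithin_mono _ fun s hs ↦ ne_of_lt hs)
    rw [← nhdsWithin_Ioo_eq_nhdsLT (ht.lt j)] at hS' ⊢
    refine (h1.mono_left (nhdsWithin_mono _ Ioo_subset_Icc_self)).congr' ?_
    filter_upwards [self_mem_nhdsWithin, hS'] with s hs hsS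
    exact (hbB j s ⟨hs, hsS⟩).symm
  · have h1 : Tendsto (B j) (𝓝[Icc (t j.castSucc) (t j.succ)] (t j.castSucc))
        (𝓝 (B j (t j.castSucc))) := hB j _ (left_mem_Icc.2 (ht.lt j).le)
    have hS' : ∀ᶠ s in 𝓝[>] (t j.castSucc), s ∉ S :=
      (eventually_notMem_of_finite hS _).filter_mono (nhdsWithin_mono _ fun s hs ↦ ne_of_gt hs)
    rw [← nhdsWithin_Ioo_eq_nhdsGT (ht.lt j)] at hS' ⊢
    refine (h1.mono_left (nhdsWithin_mono _ Ioo_subset_Icc_self)).congr' ?_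
    filter_upwards [self_mem_nhdsWithin, hS'] with s hs hsS
    exact (hbB j s ⟨hs, hsS⟩).symm
  · rw [← ht.sum_integral fun j ↦ ht.intervalIntegrable_piece hi j]
    refine Finset.sum_congr rfl fun j _ ↦ ?_
    refine MeasureTheory.integral_eq_of_hasDerivAt_off_countable_of_le (B j) b' (ht.lt j).le
      hS.countable (hB j) ?_ (ht.intervalIntegrable_piece hi j)
    intro s hs
    refine (hd s ⟨⟨(ht.mem_Icc _).1.trans_lt hs.1.1, hs.1.2.trans_le (ht.mem_Icc _).2⟩,
      hs.2⟩).congr_of_eventuallyEq ?_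
    filter_upwards [isOpen_Ioo.mem_nhds hs.1, hS.isClosed.isOpen_compl.mem_nhds hs.2]
      with s' hs' hsS
    exact (hbB j s' ⟨hs', hsS⟩).symm

end Integrals

/-! ### Variations on a strip -/

section Strips

variable {E : Type*} [NormedAddCommGroup E] [NormedSpace ℝ E]
  {M : Type*} [TopologicalSpace M] [ChartedSpace E M]

theorem uniqueDiffOn_strip (ε : ℝ) {a b : ℝ} (hab : a < b) :
    UniqueDiffOn ℝ (Ioo (-ε) ε ×ˢ Icc a b) :=
  (uniqueDiffOn_Ioo _ _).prod (uniqueDiffOn_Icc hab)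

theorem hasFDerivWithinAt_prodMk_right (r t : ℝ) (s : Set ℝ) :
    HasFDerivWithinAt (fun t : ℝ ↦ ((r, t) : ℝ × ℝ)) (ContinuousLinearMap.inr ℝ ℝ ℝ) s t :=
  (hasFDerivAt_prodMk_right r t).hasFDerivWithinAt

theorem hasFDerivWithinAt_prodMk_left (r t : ℝ) (s : Set ℝ) :
    HasFDerivWithinAt (fun r : ℝ ↦ ((r, t) : ℝ × ℝ)) (ContinuousLinearMap.inl ℝ ℝ ℝ) s r :=
  (hasFDerivAt_prodMk_left r t).hasFDerivWithinAt

theorem mapsTo_prodMk_right {r : ℝ} {I K : Set ℝ} (hr : r ∈ I) :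
    MapsTo (fun t : ℝ ↦ ((r, t) : ℝ × ℝ)) K (I ×ˢ K) := fun _ ht ↦ mk_mem_prod hr ht

theorem mapsTo_prodMk_left {t : ℝ} {I K : Set ℝ} (ht : t ∈ K) :
    MapsTo (fun r : ℝ ↦ ((r, t) : ℝ × ℝ)) I (I ×ˢ K) := fun _ hr ↦ mk_mem_prod hr ht

variable {α : ℝ → ℝ → M} {ε a b T r t κ : ℝ}

/-- On a subinterval, the velocity of a curve of a `C^1` variation is the one-sided `t`-derivative
of the restricted variation, also at the end points. -/
theorem velocity_eq_dirVel_strip {I K : Set ℝ} (hK : UniqueDiffOn ℝ K) (hKT : K ⊆ Icc 0 T)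
    (hα : ContMDiffOn 𝓘(ℝ, ℝ × ℝ) 𝓘(ℝ, E) 1 (Function.uncurry α) (I ×ˢ Icc 0 T))
    (hr : r ∈ I) (ht : t ∈ K) :
    velocity (E := E) (Icc 0 T) (α r) t = dirVel (Function.uncurry α) (I ×ˢ K) (0, 1) (r, t) := by
  have h1 : MDifferentiableWithinAt 𝓘(ℝ, ℝ) 𝓘(ℝ, E) (α r) (Icc 0 T) t := by
    have h2 : MDifferentiableWithinAt 𝓘(ℝ, ℝ) 𝓘(ℝ, ℝ × ℝ) (fun t : ℝ ↦ ((r, t) : ℝ × ℝ))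
        (Icc 0 T) t :=
      (hasFDerivWithinAt_prodMk_right r t _).differentiableWithinAt.mdifferentiableWithinAt
    exact ((hα (r, t) (mk_mem_prod hr (hKT ht))).mdifferentiableWithinAt one_ne_zero).comp t h2
      (mapsTo_prodMk_right hr)
  have h3 : velocity (E := E) (Icc 0 T) (α r) t = dirVel (E := E) (α r) K 1 t := by
    rw [velocity, dirVel, mfderivWithin_subset hKT (hK t ht).uniqueMDiffWithinAt h1]
  rw [h3]
  have h4 := dirVel_comp (E := E) (f := Function.uncurry α) (D := I ×ˢ K)
    (ℓ := fun t : ℝ ↦ ((r, t) : ℝ × ℝ)) (C := K) (s := t) (v := 1)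
    (((hα (r, t) (mk_mem_prod hr (hKT ht))).mdifferentiableWithinAt one_ne_zero).mono
      (prod_mono subset_rfl hKT)) (hK t ht) (hasFDerivWithinAt_prodMk_right r t K)
    (mapsTo_prodMk_right hr)
  rw [ContinuousLinearMap.inr_apply] at h4
  exact h4

theorem variationField_eq_dirVel (hε : 0 < ε)
    (hα : ContMDiffOn 𝓘(ℝ, ℝ × ℝ) 𝓘(ℝ, E) ∞ (Function.uncurry α) (Ioo (-ε) ε ×ˢ Icc a b))
    (ht : t ∈ Icc a b) :
    velocity (E := E) univ (fun r ↦ α r t) 0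
      = dirVel (Function.uncurry α) (Ioo (-ε) ε ×ˢ Icc a b) (1, 0) (0, t) := by
  have h0 : (0 : ℝ) ∈ Ioo (-ε) ε := ⟨by linarith, hε⟩
  have h4 := dirVel_comp (E := E) (f := Function.uncurry α) (D := Ioo (-ε) ε ×ˢ Icc a b)
    (ℓ := fun r : ℝ ↦ ((r, t) : ℝ × ℝ)) (C := Ioo (-ε) ε) (s := 0) (v := 1)
    ((hα (0, t) (mk_mem_prod h0 ht)).mdifferentiableWithinAt (by simp))
    (uniqueDiffOn_Ioo _ _ _ h0) (hasFDerivWithinAt_prodMk_left 0 t _)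
    (mapsTo_prodMk_left ht)
  have h5 : velocity (E := E) univ (fun r ↦ α r t) 0
      = dirVel (E := E) (fun r ↦ α r t) (Ioo (-ε) ε) 1 0 :=
    dirVel_congr_set (eventuallyEq_set.2 (by
      filter_upwards [isOpen_Ioo.mem_nhds h0] with r hr
      simp [hr.1, hr.2]))
  rw [h5]
  rw [ContinuousLinearMap.inl_apply] at h4
  exact h4

variable [IsManifold 𝓘(ℝ, E) ∞ M] [RiemannianBundle (fun q : M ↦ TangentSpace 𝓘(ℝ, E) q)]

theorem velocityCovDeriv_succ (s : Set ℝ) (x : ℝ → M) (k : ℕ) (t : ℝ) :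
    velocityCovDeriv (E := E) s x (k + 1) t = covDeriv s x (velocityCovDeriv s x k) t := by
  rw [velocityCovDeriv, Function.iterate_succ_apply']; rfl

/-- Covariant derivatives of the velocity are local. -/
theorem velocityCovDeriv_eq_of_mem_Ioo {s : Set ℝ} {x : ℝ → M} (hs : Ioo a b ⊆ s) (k : ℕ) :
    ∀ t ∈ Ioo a b, velocityCovDeriv (E := E) s x k t = velocityCovDeriv (Icc a b) x k t := by
  have hset : ∀ t ∈ Ioo a b, s =ᶠ[𝓝 t] Icc a b := by
    intro t ht
    filter_upwards [isOpen_Ioo.mem_nhds ht] with t' ht'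
    exact propext ⟨fun _ ↦ Ioo_subset_Icc_self ht', fun _ ↦ hs ht'⟩
  induction k with
  | zero => exact fun t ht ↦ dirVel_congr_set (hset t ht)
  | succ k ih =>
    intro t ht
    rw [velocityCovDeriv_succ, velocityCovDeriv_succ, covDeriv_eq_covAlong, covDeriv_eq_covAlong,
      covAlong_congr_set (hset t ht)]
    exact covAlong_congr (nhdsWithin_le_nhds ((isOpen_Ioo.eventually_mem ht).mono ih))
      (Ioo_subset_Icc_self ht)

/-- The `k`-th covariant derivative in `t` of the `t`-derivative of a variation. -/
def stripVel (α : ℝ → ℝ → M) (D : Set (ℝ × ℝ)) (k : ℕ) :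
    (z : ℝ × ℝ) → TangentSpace 𝓘(ℝ, E) (Function.uncurry α z) :=
  (covAlong (Function.uncurry α) D (0, 1))^[k] (dirVel (Function.uncurry α) D (0, 1))

theorem stripVel_succ (α : ℝ → ℝ → M) (D : Set (ℝ × ℝ)) (k : ℕ) :
    stripVel (E := E) α D (k + 1) = covAlong (Function.uncurry α) D (0, 1) (stripVel α D k) := by
  rw [stripVel, Function.iterate_succ_apply']; rfl

theorem covDeriv_eq_covAlong_strip (hab : a < b)
    (hα : ContMDiffOn 𝓘(ℝ, ℝ × ℝ) 𝓘(ℝ, E) ∞ (Function.uncurry α) (Ioo (-ε) ε ×ˢ Icc a b))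
    {W : (z : ℝ × ℝ) → TangentSpace 𝓘(ℝ, E) (Function.uncurry α z)}
    (hW : SmoothAlong (Function.uncurry α) (Ioo (-ε) ε ×ˢ Icc a b) W)
    (hr : r ∈ Ioo (-ε) ε) (ht : t ∈ Icc a b) :
    covDeriv (E := E) (Icc a b) (α r) (fun t ↦ W (r, t)) t
      = covAlong (Function.uncurry α) (Ioo (-ε) ε ×ˢ Icc a b) (0, 1) W (r, t) := by
  have h := covAlong_comp (ℓ := fun t : ℝ ↦ ((r, t) : ℝ × ℝ)) (C := Icc a b) (s := t) (v := 1)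
    hW hα (uniqueDiffOn_Icc hab t ht) ht (hasFDerivWithinAt_prodMk_right r t _)
    (mapsTo_prodMk_right hr)
  rw [ContinuousLinearMap.inr_apply] at h
  exact h

variable [FiniteDimensional ℝ E]
  [IsContMDiffRiemannianBundle 𝓘(ℝ, E) ∞ E (fun p : M ↦ TangentSpace 𝓘(ℝ, E) p)]

theorem smoothAlong_velocityCovDeriv {x : ℝ → M} (hab : a < b)
    (hx : ContMDiffOn 𝓘(ℝ, ℝ) 𝓘(ℝ, E) ∞ x (Icc a b)) (k : ℕ) :
    SmoothAlong x (Icc a b) (velocityCovDeriv (E := E) (Icc a b) x k) := by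
  induction k with
  | zero => exact smoothAlong_dirVel hx (uniqueDiffOn_Icc hab)
  | succ k ih =>
    exact (ih.covAlong (e := 1) hx (uniqueDiffOn_Icc hab)).congr
      fun t _ ↦ velocityCovDeriv_succ _ _ k t

theorem smoothAlong_stripVel (hab : a < b)
    (hα : ContMDiffOn 𝓘(ℝ, ℝ × ℝ) 𝓘(ℝ, E) ∞ (Function.uncurry α) (Ioo (-ε) ε ×ˢ Icc a b)) (k : ℕ) :
    SmoothAlong (Function.uncurry α) (Ioo (-ε) ε ×ˢ Icc a b)
      (stripVel (E := E) α (Ioo (-ε) ε ×ˢ Icc a b) k) := by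
  induction k with
  | zero => exact smoothAlong_dirVel hα (uniqueDiffOn_strip ε hab)
  | succ k ih =>
    rw [stripVel_succ]
    exact ih.covAlong hα (uniqueDiffOn_strip ε hab)

theorem velocityCovDeriv_eq_stripVel (hab : a < b)
    (hα : ContMDiffOn 𝓘(ℝ, ℝ × ℝ) 𝓘(ℝ, E) ∞ (Function.uncurry α) (Ioo (-ε) ε ×ˢ Icc a b))
    (hr : r ∈ Ioo (-ε) ε) (k : ℕ) : ∀ t ∈ Icc a b,
    velocityCovDeriv (E := E) (Icc a b) (α r) k t
      = stripVel α (Ioo (-ε) ε ×ˢ Icc a b) k (r, t) := by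
  induction k with
  | zero =>
    intro t ht
    have h4 := dirVel_comp (E := E) (f := Function.uncurry α) (D := Ioo (-ε) ε ×ˢ Icc a b)
      (ℓ := fun t : ℝ ↦ ((r, t) : ℝ × ℝ)) (C := Icc a b) (s := t) (v := 1)
      ((hα (r, t) (mk_mem_prod hr ht)).mdifferentiableWithinAt (by simp))
      (uniqueDiffOn_Icc hab t ht) (hasFDerivWithinAt_prodMk_right r t _)
      (mapsTo_prodMk_right hr)
    rw [ContinuousLinearMap.inr_apply] at h4
    exact h4
  | succ k ih =>
    intro t ht
    rw [velocityCovDeriv_succ, stripVel_succ,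
      ← covDeriv_eq_covAlong_strip hab hα (smoothAlong_stripVel hab hα k) hr ht]
    exact covAlong_congr (eventually_nhdsWithin_of_forall ih) ht

/-- In the interior of a strip, covariant derivatives of the velocity of the curves of a variation
are covariant derivatives of the variation. -/
theorem velocityCovDeriv_eq_stripVel_of_mem_Ioo (hab : a < b) (hT : Icc a b ⊆ Icc 0 T)
    (hα : ContMDiffOn 𝓘(ℝ, ℝ × ℝ) 𝓘(ℝ, E) ∞ (Function.uncurry α) (Ioo (-ε) ε ×ˢ Icc a b))
    (hr : r ∈ Ioo (-ε) ε) (ht : t ∈ Ioo a b) (k : ℕ) :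
    velocityCovDeriv (E := E) (Icc 0 T) (α r) k t
      = stripVel α (Ioo (-ε) ε ×ˢ Icc a b) k (r, t) := by
  rw [velocityCovDeriv_eq_of_mem_Ioo (Ioo_subset_Icc_self.trans hT) k t ht]
  exact velocityCovDeriv_eq_stripVel hab hα hr k t (Ioo_subset_Icc_self ht)

/-- The covariant derivative in `r` at `r = 0` of the velocities of the curves of a variation. It is
the continuous extension to `[0, T]` of the covariant derivative of the variational vector field,
which is not meaningful itself at the break points of the variation. -/
def varVelocity (ε T : ℝ) (α : ℝ → ℝ → M) (t : ℝ) : TangentSpace 𝓘(ℝ, E) (α 0 t) :=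
  covDeriv (Ioo (-ε) ε) (fun r ↦ α r t) (fun r ↦ velocity (Icc 0 T) (α r) t) 0

theorem varVelocity_eq_covAlong (hε : 0 < ε) (hab : a < b) (hT : Icc a b ⊆ Icc 0 T)
    (hα1 : ContMDiffOn 𝓘(ℝ, ℝ × ℝ) 𝓘(ℝ, E) 1 (Function.uncurry α) (Ioo (-ε) ε ×ˢ Icc 0 T))
    (hα : ContMDiffOn 𝓘(ℝ, ℝ × ℝ) 𝓘(ℝ, E) ∞ (Function.uncurry α) (Ioo (-ε) ε ×ˢ Icc a b))
    (ht : t ∈ Icc a b) :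
    varVelocity (E := E) ε T α t = covAlong (Function.uncurry α) (Ioo (-ε) ε ×ˢ Icc a b) (1, 0)
      (stripVel α (Ioo (-ε) ε ×ˢ Icc a b) 0) (0, t) := by
  have h0 : (0 : ℝ) ∈ Ioo (-ε) ε := ⟨by linarith, hε⟩
  have h := covAlong_comp (ℓ := fun r : ℝ ↦ ((r, t) : ℝ × ℝ)) (C := Ioo (-ε) ε) (s := 0) (v := 1)
    (smoothAlong_stripVel hab hα 0) hα (uniqueDiffOn_Ioo _ _ _ h0) h0
    (hasFDerivWithinAt_prodMk_left 0 t _) (mapsTo_prodMk_left ht)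
  rw [ContinuousLinearMap.inl_apply] at h
  rw [← h]
  have hv : ∀ r ∈ Ioo (-ε) ε, velocity (E := E) (Icc 0 T) (α r) t
      = stripVel (E := E) α (Ioo (-ε) ε ×ˢ Icc a b) 0 (r, t) := fun r hr ↦
    velocity_eq_dirVel_strip (uniqueDiffOn_Icc hab) hT hα1 hr ht
  exact covAlong_congr (f := fun r ↦ α r t)
    (Z := fun r ↦ stripVel α (Ioo (-ε) ε ×ˢ Icc a b) 0 (r, t))
    (eventually_nhdsWithin_of_forall hv) h0

end Strips

/-! ### The first variation of the density of one trajectory -/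

section SingleAgent

variable {E : Type*} [NormedAddCommGroup E] [NormedSpace ℝ E] [FiniteDimensional ℝ E]
  {M : Type*} [TopologicalSpace M] [ChartedSpace E M] [IsManifold 𝓘(ℝ, E) ∞ M]
  [RiemannianBundle (fun q : M ↦ TangentSpace 𝓘(ℝ, E) q)]

/-- The contribution of a single trajectory to the energy density, without the potential. -/
def agentDensity (κ T : ℝ) (x : ℝ → M) (t : ℝ) : ℝ :=
  (1 / 2) * (‖velocityCovDeriv (E := E) (Icc 0 T) x 1 t‖ ^ 2
    + κ * ‖velocity (E := E) (Icc 0 T) x t‖ ^ 2)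

/-- The left hand side of the Euler-Lagrange equation of a single trajectory, without the
potential. -/
def agentEulerLagrange (κ T : ℝ) (x : ℝ → M) (t : ℝ) : TangentSpace 𝓘(ℝ, E) (x t) :=
  velocityCovDeriv (Icc 0 T) x 3 t - κ • velocityCovDeriv (Icc 0 T) x 1 t
    + curvature (x t) (velocityCovDeriv (Icc 0 T) x 1 t) (velocity (Icc 0 T) x t)
        (velocity (Icc 0 T) x t)

/-- The energy density, without the potential, of the curves of a variation on a strip `D`, in terms
of derivatives within `D`. -/
def stripDensity (E : Type*) [NormedAddCommGroup E] [NormedSpace ℝ E]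
    {M : Type*} [TopologicalSpace M] [ChartedSpace E M] [IsManifold 𝓘(ℝ, E) ∞ M]
    [RiemannianBundle (fun q : M ↦ TangentSpace 𝓘(ℝ, E) q)]
    (κ : ℝ) (α : ℝ → ℝ → M) (D : Set (ℝ × ℝ)) (z : ℝ × ℝ) : ℝ :=
  (1 / 2) * (inner ℝ (stripVel (E := E) α D 1 z) (stripVel α D 1 z)
    + κ * inner ℝ (stripVel (E := E) α D 0 z) (stripVel α D 0 z))

/-- The boundary expression of the curves of a variation on a strip `D`, in terms of derivatives
within `D`, with `D/∂r ∂α/∂t` in place of `DX/dt`. -/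
def stripBoundary (E : Type*) [NormedAddCommGroup E] [NormedSpace ℝ E]
    {M : Type*} [TopologicalSpace M] [ChartedSpace E M] [IsManifold 𝓘(ℝ, E) ∞ M]
    [RiemannianBundle (fun q : M ↦ TangentSpace 𝓘(ℝ, E) q)]
    (κ : ℝ) (α : ℝ → ℝ → M) (D : Set (ℝ × ℝ)) (z : ℝ × ℝ) : ℝ :=
  inner ℝ (covAlong (E := E) (Function.uncurry α) D (1, 0) (stripVel α D 0) z) (stripVel α D 1 z)
    + (κ * inner ℝ (dirVel (E := E) (Function.uncurry α) D (1, 0) z) (stripVel α D 0 z)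
      - inner ℝ (dirVel (E := E) (Function.uncurry α) D (1, 0) z) (stripVel α D 2 z))

variable {α : ℝ → ℝ → M} {ε a b T r t κ : ℝ}
  [IsContMDiffRiemannianBundle 𝓘(ℝ, E) ∞ E (fun p : M ↦ TangentSpace 𝓘(ℝ, E) p)]

theorem contDiffOn_stripDensity (hab : a < b)
    (hα : ContMDiffOn 𝓘(ℝ, ℝ × ℝ) 𝓘(ℝ, E) ∞ (Function.uncurry α) (Ioo (-ε) ε ×ˢ Icc a b)) :
    ContDiffOn ℝ ∞ (stripDensity E κ α (Ioo (-ε) ε ×ˢ Icc a b)) (Ioo (-ε) ε ×ˢ Icc a b) := by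
  have h := smoothAlong_stripVel hab hα
  exact contDiffOn_const.mul (((h 1).contDiffOn_inner (h 1) hα).add
    (contDiffOn_const.mul ((h 0).contDiffOn_inner (h 0) hα)))

theorem contDiffOn_stripBoundary (hab : a < b)
    (hα : ContMDiffOn 𝓘(ℝ, ℝ × ℝ) 𝓘(ℝ, E) ∞ (Function.uncurry α) (Ioo (-ε) ε ×ˢ Icc a b)) :
    ContDiffOn ℝ ∞ (stripBoundary E κ α (Ioo (-ε) ε ×ˢ Icc a b)) (Ioo (-ε) ε ×ˢ Icc a b) := by
  have h := smoothAlong_stripVel hab hα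
  have hD := uniqueDiffOn_strip ε hab
  have hX := smoothAlong_dirVel (e := ((1 : ℝ), (0 : ℝ))) hα hD
  exact (((h 0).covAlong hα hD).contDiffOn_inner (h 1) hα).add
    ((contDiffOn_const.mul (hX.contDiffOn_inner (h 0) hα)).sub (hX.contDiffOn_inner (h 2) hα))

/-- The first variation formula in differential form: the `r`-derivative of the energy density is
the Euler-Lagrange expression paired with the variational field, plus the `t`-derivative of the
boundary expression. -/
theorem fderivWithin_stripDensity (hab : a < b)
    (hα : ContMDiffOn 𝓘(ℝ, ℝ × ℝ) 𝓘(ℝ, E) ∞ (Function.uncurry α) (Ioo (-ε) ε ×ˢ Icc a b))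
    {z : ℝ × ℝ} (hz : z ∈ interior (Ioo (-ε) ε ×ˢ Icc a b)) :
    fderivWithin ℝ (stripDensity E κ α (Ioo (-ε) ε ×ˢ Icc a b)) (Ioo (-ε) ε ×ˢ Icc a b) z (1, 0)
      = inner ℝ (dirVel (E := E) (Function.uncurry α) (Ioo (-ε) ε ×ˢ Icc a b) (1, 0) z)
          (stripVel α (Ioo (-ε) ε ×ˢ Icc a b) 3 z - κ • stripVel α (Ioo (-ε) ε ×ˢ Icc a b) 1 z
            + curvature (Function.uncurry α z) (stripVel α (Ioo (-ε) ε ×ˢ Icc a b) 1 z)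
              (stripVel α (Ioo (-ε) ε ×ˢ Icc a b) 0 z) (stripVel α (Ioo (-ε) ε ×ˢ Icc a b) 0 z))
        + fderivWithin ℝ (stripBoundary E κ α (Ioo (-ε) ε ×ˢ Icc a b))
            (Ioo (-ε) ε ×ˢ Icc a b) z (0, 1) := by
  have hD := uniqueDiffOn_strip ε hab
  set D : Set (ℝ × ℝ) := Ioo (-ε) ε ×ˢ Icc a b with hDdef
  have hzD : z ∈ D := interior_subset hz
  have hzc : z ∈ closure (interior D) := subset_closure hz
  set f : ℝ × ℝ → M := Function.uncurry α with hf
  have h : ∀ k, SmoothAlong f D (stripVel (E := E) α D k) := smoothAlong_stripVel hab hα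
  have hX : SmoothAlong f D (dirVel (E := E) f D (1, 0)) := smoothAlong_dirVel hα hD
  have hY : SmoothAlong f D (covAlong (E := E) f D (1, 0) (stripVel α D 0)) :=
    (h 0).covAlong hα hD
  have hdiff : ∀ {W Z : (z : ℝ × ℝ) → TangentSpace 𝓘(ℝ, E) (f z)}, SmoothAlong f D W →
      SmoothAlong f D Z →
      DifferentiableWithinAt ℝ (fun z ↦ (inner ℝ (W z) (Z z) : ℝ)) D z := fun hW hZ ↦
    (hW.contDiffOn_inner hZ hα z hzD).differentiableWithinAt (by simp)
  have hu := hD z hzD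
  have hs : ∀ k, covAlong (E := E) f D (0, 1) (stripVel α D k) = stripVel α D (k + 1) :=
    fun k ↦ (stripVel_succ α D k).symm
  -- the `r`-derivative of the density
  have h1 : fderivWithin ℝ (stripDensity E κ α D) D z (1, 0)
      = inner ℝ (covAlong (E := E) f D (1, 0) (stripVel α D 1) z) (stripVel α D 1 z)
        + κ * inner ℝ (covAlong (E := E) f D (1, 0) (stripVel α D 0) z) (stripVel α D 0 z) := by
    have e : HasFDerivWithinAt (stripDensity E κ α D) _ D z :=
      ((hdiff (h 1) (h 1)).hasFDerivWithinAt.add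
        ((hdiff (h 0) (h 0)).hasFDerivWithinAt.const_mul κ)).const_mul (1 / 2)
    rw [e.fderivWithin hu]
    simp only [smul_apply, add_apply, smul_eq_mul]
    rw [fderivWithin_inner_eq (h 1) (h 1) hα hD hzD, fderivWithin_inner_eq (h 0) (h 0) hα hD hzD,
      real_inner_comm (covAlong (E := E) f D (1, 0) (stripVel α D 1) z),
      real_inner_comm (covAlong (E := E) f D (1, 0) (stripVel α D 0) z)]
    ring
  -- the `t`-derivative of the boundary expression
  have h2 : fderivWithin ℝ (stripBoundary E κ α D) D z (0, 1)
      = inner ℝ (covAlong (E := E) f D (0, 1) (covAlong f D (1, 0) (stripVel α D 0)) z)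
          (stripVel α D 1 z)
        + inner ℝ (covAlong (E := E) f D (1, 0) (stripVel α D 0) z) (stripVel α D 2 z)
        + (κ * (inner ℝ (covAlong (E := E) f D (0, 1) (dirVel f D (1, 0)) z) (stripVel α D 0 z)
            + inner ℝ (dirVel (E := E) f D (1, 0) z) (stripVel α D 1 z))
          - (inner ℝ (covAlong (E := E) f D (0, 1) (dirVel f D (1, 0)) z) (stripVel α D 2 z)
            + inner ℝ (dirVel (E := E) f D (1, 0) z) (stripVel α D 3 z))) := by
    have e : HasFDerivWithinAt (stripBoundary E κ α D) _ D z :=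
      (hdiff hY (h 1)).hasFDerivWithinAt.add
        (((hdiff hX (h 0)).hasFDerivWithinAt.const_mul κ).sub (hdiff hX (h 2)).hasFDerivWithinAt)
    rw [e.fderivWithin hu]
    simp only [smul_apply, add_apply, sub_apply, smul_eq_mul]
    rw [fderivWithin_inner_eq hY (h 1) hα hD hzD, fderivWithin_inner_eq hX (h 0) hα hD hzD,
      fderivWithin_inner_eq hX (h 2) hα hD hzD, hs 0, hs 1, hs 2]
  have h3 : covAlong (E := E) f D (0, 1) (dirVel f D (1, 0)) z
      = covAlong f D (1, 0) (stripVel α D 0) z := covAlong_dirVel_comm hα hD hzD hzc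
  have h4 : covAlong (E := E) f D (1, 0) (stripVel α D 1) z
      = covAlong f D (0, 1) (covAlong f D (1, 0) (stripVel α D 0)) z
        + curvature (f z) (dirVel f D (1, 0) z) (stripVel α D 0 z) (stripVel α D 0 z) := by
    rw [stripVel_succ α D 0, ← sub_eq_iff_eq_add']
    exact covAlong_covAlong_sub (h 0) hα hD hzD hzc
  rw [h1, h2, h3, h4, inner_add_left, inner_curvature_symm, inner_add_right, inner_sub_right,
    inner_smul_right, real_inner_comm (dirVel (E := E) f D (1, 0) z)]
  ring

section Strip

variable (hε : 0 < ε) (hab : a < b) (hT : Icc a b ⊆ Icc 0 T)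
  (hα : ContMDiffOn 𝓘(ℝ, ℝ × ℝ) 𝓘(ℝ, E) ∞ (Function.uncurry α) (Ioo (-ε) ε ×ˢ Icc a b))

include hab hT hα in
theorem agentDensity_eq_stripDensity (hr : r ∈ Ioo (-ε) ε) (ht : t ∈ Ioo a b) :
    agentDensity (E := E) κ T (α r) t
      = stripDensity E κ α (Ioo (-ε) ε ×ˢ Icc a b) (r, t) := by
  have h := velocityCovDeriv_eq_stripVel_of_mem_Ioo hab hT hα hr ht
  have h0 : velocity (E := E) (Icc 0 T) (α r) t = _ := h 0
  rw [agentDensity, h 1, h0, stripDensity, real_inner_self_eq_norm_sq, real_inner_self_eq_norm_sq]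
  rfl

variable {X : (t : ℝ) → TangentSpace 𝓘(ℝ, E) (α 0 t)}
  (hX : ∀ t ∈ Icc 0 T, X t = velocity univ (fun r ↦ α r t) 0)

include hε hab hT hα hX in
/-- In the interior of a strip, the covariant derivative of the variational field is the covariant
derivative in the direction of the variation of the velocities. -/
theorem covDeriv_variationField (ht : t ∈ Ioo a b) :
    covDeriv (Icc 0 T) (α 0) X t = covAlong (E := E) (Function.uncurry α)
      (Ioo (-ε) ε ×ˢ Icc a b) (1, 0) (stripVel α (Ioo (-ε) ε ×ˢ Icc a b) 0) (0, t) := by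
  have h0 : (0 : ℝ) ∈ Ioo (-ε) ε := ⟨by linarith, hε⟩
  have hD := uniqueDiffOn_strip ε hab
  have htc := Ioo_subset_Icc_self ht
  have hXt : ∀ t ∈ Icc a b, X t = dirVel (E := E) (Function.uncurry α)
      (Ioo (-ε) ε ×ˢ Icc a b) (1, 0) (0, t) := fun t ht ↦ by
    rw [hX t (hT ht)]; exact variationField_eq_dirVel hε hα ht
  have hset : Icc 0 T =ᶠ[𝓝 t] Icc a b := by
    filter_upwards [isOpen_Ioo.mem_nhds ht] with t' ht'
    exact propext ⟨fun _ ↦ Ioo_subset_Icc_self ht', fun _ ↦ hT (Ioo_subset_Icc_self ht')⟩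
  have hz : ((0 : ℝ), t) ∈ Ioo (-ε) ε ×ˢ Icc a b := mk_mem_prod h0 htc
  have hz' : ((0 : ℝ), t) ∈ interior (Ioo (-ε) ε ×ˢ Icc a b) :=
    mem_interior_iff_mem_nhds.2 (prod_mem_nhds (isOpen_Ioo.mem_nhds h0) (Icc_mem_nhds ht.1 ht.2))
  have e1 : covDeriv (Icc 0 T) (α 0) X t = covDeriv (E := E) (Icc a b) (α 0)
      (fun t ↦ dirVel (Function.uncurry α) (Ioo (-ε) ε ×ˢ Icc a b) (1, 0) (0, t)) t :=
    (covAlong_congr_set hset).trans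
      (covAlong_congr (f := α 0) (eventually_nhdsWithin_of_forall hXt) htc)
  rw [e1, covDeriv_eq_covAlong_strip hab hα (smoothAlong_dirVel hα hD) h0 htc]
  exact covAlong_dirVel_comm hα hD hz (subset_closure hz')

include hε hab hT hα hX in
theorem boundaryTerm_eq_stripBoundary (ht : t ∈ Ioo a b) :
    boundaryTerm κ T (α 0) X t = stripBoundary E κ α (Ioo (-ε) ε ×ˢ Icc a b) (0, t) := by
  have htc := Ioo_subset_Icc_self ht
  have h := velocityCovDeriv_eq_stripVel_of_mem_Ioo hab hT hα ⟨by linarith, hε⟩ ht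
  have hv : velocity (E := E) (Icc 0 T) (α 0) t = _ := h 0
  rw [boundaryTerm, inner_sub_right, inner_smul_right,
    covDeriv_variationField hε hab hT hα hX ht, h 1, h 2, hv, hX t (hT htc),
    variationField_eq_dirVel hε hα htc]
  rfl

include hε hab hT hα hX in
theorem hasDerivAt_boundaryTerm (ht : t ∈ Ioo a b) :
    HasDerivAt (boundaryTerm κ T (α 0) X) (fderivWithin ℝ
      (stripBoundary E κ α (Ioo (-ε) ε ×ˢ Icc a b)) (Ioo (-ε) ε ×ˢ Icc a b) (0, t) (0, 1)) t := by
  have h0 : (0 : ℝ) ∈ Ioo (-ε) ε := ⟨by linarith, hε⟩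
  have htc := Ioo_subset_Icc_self ht
  have h1 := ((contDiffOn_stripBoundary (κ := κ) hab hα) (0, t)
    (mk_mem_prod h0 htc)).differentiableWithinAt (by simp) |>.hasFDerivWithinAt
  have h2 := h1.comp t (hasFDerivWithinAt_prodMk_right 0 t (Icc a b)) (mapsTo_prodMk_right h0)
  have h3 := h2.hasDerivWithinAt.hasDerivAt (Icc_mem_nhds ht.1 ht.2)
  simp only [ContinuousLinearMap.comp_apply, ContinuousLinearMap.inr_apply] at h3
  refine h3.congr_of_eventuallyEq ?_
  filter_upwards [isOpen_Ioo.mem_nhds ht] with t' ht'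
  exact boundaryTerm_eq_stripBoundary hε hab hT hα hX ht'

include hε hab hT hα in
theorem deriv_agentDensity (ht : t ∈ Ioo a b) :
    deriv (fun r ↦ agentDensity (E := E) κ T (α r) t) 0
      = fderivWithin ℝ (stripDensity E κ α (Ioo (-ε) ε ×ˢ Icc a b))
          (Ioo (-ε) ε ×ˢ Icc a b) (0, t) (1, 0) := by
  have h0 : (0 : ℝ) ∈ Ioo (-ε) ε := ⟨by linarith, hε⟩
  have htc := Ioo_subset_Icc_self ht
  have h1 := ((contDiffOn_stripDensity (κ := κ) hab hα) (0, t)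
    (mk_mem_prod h0 htc)).differentiableWithinAt (by simp) |>.hasFDerivWithinAt
  have h2 := h1.comp 0 (hasFDerivWithinAt_prodMk_left 0 t (Ioo (-ε) ε)) (mapsTo_prodMk_left htc)
  have h3 := h2.hasDerivWithinAt.hasDerivAt (isOpen_Ioo.mem_nhds h0)
  simp only [ContinuousLinearMap.comp_apply, ContinuousLinearMap.inl_apply] at h3
  refine (h3.congr_of_eventuallyEq ?_).deriv
  filter_upwards [isOpen_Ioo.mem_nhds h0] with r hr
  exact agentDensity_eq_stripDensity hab hT hα hr ht

include hε hab hT hα hX in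
/-- The first variation formula in differential form, in terms of the trajectory `α 0`. -/
theorem deriv_agentDensity_eq (ht : t ∈ Ioo a b) :
    deriv (fun r ↦ agentDensity (E := E) κ T (α r) t) 0
      = inner ℝ (X t) (agentEulerLagrange κ T (α 0) t) + deriv (boundaryTerm κ T (α 0) X) t := by
  have h0 : (0 : ℝ) ∈ Ioo (-ε) ε := ⟨by linarith, hε⟩
  have htc := Ioo_subset_Icc_self ht
  have h := velocityCovDeriv_eq_stripVel_of_mem_Ioo hab hT hα h0 ht
  have hv : velocity (E := E) (Icc 0 T) (α 0) t = _ := h 0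
  have hz' : ((0 : ℝ), t) ∈ interior (Ioo (-ε) ε ×ˢ Icc a b) :=
    mem_interior_iff_mem_nhds.2 (prod_mem_nhds (isOpen_Ioo.mem_nhds h0) (Icc_mem_nhds ht.1 ht.2))
  rw [deriv_agentDensity hε hab hT hα ht, fderivWithin_stripDensity hab hα hz',
    (hasDerivAt_boundaryTerm hε hab hT hα hX ht).deriv, agentEulerLagrange, h 1, h 3, hv,
    hX t (hT htc), variationField_eq_dirVel hε hα htc]
  rfl

include hε hab hT hα hX in
theorem intervalIntegrable_deriv_boundaryTerm :
    IntervalIntegrable (deriv (boundaryTerm κ T (α 0) X)) volume a b := by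
  have h0 : (0 : ℝ) ∈ Ioo (-ε) ε := ⟨by linarith, hε⟩
  have h1 : ContinuousOn (fun t ↦ fderivWithin ℝ (stripBoundary E κ α (Ioo (-ε) ε ×ˢ Icc a b))
      (Ioo (-ε) ε ×ˢ Icc a b) (0, t) (0, 1)) (Icc a b) :=
    (((contDiffOn_stripBoundary (κ := κ) hab hα).continuousOn_fderivWithin
      (uniqueDiffOn_strip ε hab) (by simp)).clm_apply continuousOn_const).comp
      (by fun_prop) (mapsTo_prodMk_right h0)
  refine (h1.intervalIntegrable_of_Icc hab.le).congr_uIoo fun t ht ↦ ?_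
  rw [uIoo_of_le hab.le] at ht
  exact (hasDerivAt_boundaryTerm hε hab hT hα hX ht).deriv.symm

end Strip

end SingleAgent

/-! ### The first variation of the energy of one trajectory -/

section SingleAgentPieces

variable {E : Type*} [NormedAddCommGroup E] [NormedSpace ℝ E] [FiniteDimensional ℝ E]
  {M : Type*} [TopologicalSpace M] [ChartedSpace E M] [IsManifold 𝓘(ℝ, E) ∞ M]
  [RiemannianBundle (fun q : M ↦ TangentSpace 𝓘(ℝ, E) q)]
  [IsContMDiffRiemannianBundle 𝓘(ℝ, E) ∞ E (fun p : M ↦ TangentSpace 𝓘(ℝ, E) p)]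
  {α : ℝ → ℝ → M} {ε a b c d T t κ : ℝ} {X : (t : ℝ) → TangentSpace 𝓘(ℝ, E) (α 0 t)}

/-- The boundary expression on a piece `[c, d]` on which `α 0` is smooth: the derivatives of `α 0`
are one-sided at `c` and `d`, and the covariant derivative of the variational field is replaced by
its continuous extension. -/
def boundaryExtension (κ ε T c d : ℝ) (α : ℝ → ℝ → M)
    (X : (t : ℝ) → TangentSpace 𝓘(ℝ, E) (α 0 t)) (t : ℝ) : ℝ :=
  inner ℝ (varVelocity (E := E) ε T α t) (velocityCovDeriv (E := E) (Icc c d) (α 0) 1 t)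
    + (κ * inner ℝ (X t) (velocityCovDeriv (E := E) (Icc c d) (α 0) 0 t)
      - inner ℝ (X t) (velocityCovDeriv (E := E) (Icc c d) (α 0) 2 t))

/-- On the intersection of a piece on which `α 0` is smooth with a piece on which the variation is
smooth, the boundary extension is continuous. -/
theorem continuousOn_boundaryExtension (hε : 0 < ε) (hab : a < b) (hT : Icc a b ⊆ Icc 0 T)
    (hα1 : ContMDiffOn 𝓘(ℝ, ℝ × ℝ) 𝓘(ℝ, E) 1 (Function.uncurry α) (Ioo (-ε) ε ×ˢ Icc 0 T))
    (hα : ContMDiffOn 𝓘(ℝ, ℝ × ℝ) 𝓘(ℝ, E) ∞ (Function.uncurry α) (Ioo (-ε) ε ×ˢ Icc a b))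
    (hX : ∀ t ∈ Icc 0 T, X t = velocity univ (fun r ↦ α r t) 0)
    (hcd : c < d) (hx : ContMDiffOn 𝓘(ℝ, ℝ) 𝓘(ℝ, E) ∞ (α 0) (Icc c d)) :
    ContinuousOn (boundaryExtension κ ε T c d α X) (Icc a b ∩ Icc c d) := by
  have h0 : (0 : ℝ) ∈ Ioo (-ε) ε := ⟨by linarith, hε⟩
  have hD := uniqueDiffOn_strip ε hab
  have hline : ContDiffOn ℝ ∞ (fun t : ℝ ↦ ((0, t) : ℝ × ℝ)) (Icc a b) := by fun_prop
  have hsub : Icc a b ∩ Icc c d ⊆ Icc a b := inter_subset_left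
  have hsub' : Icc a b ∩ Icc c d ⊆ Icc c d := inter_subset_right
  have hY : SmoothAlong (α 0) (Icc a b ∩ Icc c d) (varVelocity (E := E) ε T α) :=
    (((((smoothAlong_stripVel hab hα 0).covAlong (e := (1, 0)) hα hD).comp hline
      (mapsTo_prodMk_right h0)).congr (f := α 0)
      fun t ht ↦ varVelocity_eq_covAlong hε hab hT hα1 hα ht)).mono hsub
  have hX' : SmoothAlong (α 0) (Icc a b ∩ Icc c d) X :=
    (((smoothAlong_dirVel (e := (1, 0)) hα hD).comp hline
      (mapsTo_prodMk_right h0)).congr (f := α 0) (Z := X) fun t ht ↦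
        (hX t (hT ht)).trans (variationField_eq_dirVel hε hα ht)).mono hsub
  have hv := fun k ↦ (smoothAlong_velocityCovDeriv hcd hx k).mono hsub'
  have hx' := hx.mono hsub'
  exact (hY.contDiffOn_inner (hv 1) hx').continuousOn.add
    ((continuousOn_const.mul (hX'.contDiffOn_inner (hv 0) hx').continuousOn).sub
      (hX'.contDiffOn_inner (hv 2) hx').continuousOn)

theorem boundaryTerm_eq_boundaryExtension (hε : 0 < ε) (hab : a < b) (hT : Icc a b ⊆ Icc 0 T)
    (hα1 : ContMDiffOn 𝓘(ℝ, ℝ × ℝ) 𝓘(ℝ, E) 1 (Function.uncurry α) (Ioo (-ε) ε ×ˢ Icc 0 T))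
    (hα : ContMDiffOn 𝓘(ℝ, ℝ × ℝ) 𝓘(ℝ, E) ∞ (Function.uncurry α) (Ioo (-ε) ε ×ˢ Icc a b))
    (hX : ∀ t ∈ Icc 0 T, X t = velocity univ (fun r ↦ α r t) 0)
    (hcd : Icc c d ⊆ Icc 0 T) (ht : t ∈ Ioo a b) (ht' : t ∈ Ioo c d) :
    boundaryTerm κ T (α 0) X t = boundaryExtension κ ε T c d α X t := by
  have h := fun k ↦ velocityCovDeriv_eq_of_mem_Ioo (E := E) (x := α 0)
    (Ioo_subset_Icc_self.trans hcd) k t ht'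
  have hv : velocity (E := E) (Icc 0 T) (α 0) t = _ := h 0
  rw [boundaryTerm, inner_sub_right, inner_smul_right,
    covDeriv_variationField hε hab hT hα hX ht,
    ← varVelocity_eq_covAlong hε hab hT hα1 hα (Ioo_subset_Icc_self ht), h 1, h 2, hv]
  rfl

/-- The first variation formula for the part of the energy that comes from one trajectory: the
energy can be differentiated under the integral sign, and the integral of the derivative of the
boundary expression is a sum of jumps over any partition such that the trajectory is smooth on its
pieces. -/
theorem firstVariation_agent (hε : 0 < ε)
    (hα1 : ContMDiffOn 𝓘(ℝ, ℝ × ℝ) 𝓘(ℝ, E) 1 (Function.uncurry α) (Ioo (-ε) ε ×ˢ Icc 0 T))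
    {m : ℕ} {s : Fin (m + 1) → ℝ} (hs : IsPartition T s)
    (hα : ∀ j : Fin m, ContMDiffOn 𝓘(ℝ, ℝ × ℝ) 𝓘(ℝ, E) ∞ (Function.uncurry α)
      (Ioo (-ε) ε ×ˢ Icc (s j.castSucc) (s j.succ)))
    (hX : ∀ t ∈ Icc 0 T, X t = velocity univ (fun r ↦ α r t) 0)
    {l : ℕ} {τ : Fin (l + 1) → ℝ} (hτ : IsPartition T τ) (hx : IsSmoothOnPieces E τ (α 0)) :
    (∀ r ∈ Ioo (-ε) ε, IntervalIntegrable (agentDensity (E := E) κ T (α r)) volume 0 T) ∧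
    IntervalIntegrable (fun t ↦ deriv (fun r ↦ agentDensity (E := E) κ T (α r) t) 0)
      volume 0 T ∧
    HasDerivAt (fun r ↦ ∫ t in (0 : ℝ)..T, agentDensity (E := E) κ T (α r) t)
      (∫ t in (0 : ℝ)..T, deriv (fun r ↦ agentDensity (E := E) κ T (α r) t) 0) 0 ∧
    IntervalIntegrable (deriv (boundaryTerm κ T (α 0) X)) volume 0 T ∧
    (∀ t ∈ Ioo 0 T \ range s, deriv (fun r ↦ agentDensity (E := E) κ T (α r) t) 0
      = inner ℝ (X t) (agentEulerLagrange κ T (α 0) t)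
        + deriv (boundaryTerm κ T (α 0) X) t) ∧
    ∃ bLeft bRight : Fin l → ℝ,
      (∀ j, Tendsto (boundaryTerm κ T (α 0) X) (𝓝[<] (τ j.succ)) (𝓝 (bLeft j))) ∧
      (∀ j, Tendsto (boundaryTerm κ T (α 0) X) (𝓝[>] (τ j.castSucc)) (𝓝 (bRight j))) ∧
      ∫ t in (0 : ℝ)..T, deriv (boundaryTerm κ T (α 0) X) t = ∑ j, (bLeft j - bRight j) := by
  have hsT := fun j ↦ hs.Icc_subset j
  obtain ⟨h1, h2, h3⟩ := hs.hasDerivAt_integral hε (F := fun r ↦ agentDensity (E := E) κ T (α r))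
    fun j ↦ ⟨stripDensity E κ α (Ioo (-ε) ε ×ˢ Icc (s j.castSucc) (s j.succ)),
      (contDiffOn_stripDensity (hs.lt j) (hα j)).of_le (by simp),
      fun r hr t ht ↦ agentDensity_eq_stripDensity (hs.lt j) (hsT j) (hα j) hr ht⟩
  have h4 : IntervalIntegrable (deriv (boundaryTerm κ T (α 0) X)) volume 0 T :=
    hs.intervalIntegrable fun j ↦
      intervalIntegrable_deriv_boundaryTerm hε (hs.lt j) (hsT j) (hα j) hX
  refine ⟨h1, h2, h3, h4, fun t ht ↦ ?_, ?_⟩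
  · obtain ⟨j, hj⟩ := hs.exists_mem_Ioo ht.1 ht.2
    exact deriv_agentDensity_eq hε (hs.lt j) (hsT j) (hα j) hX hj
  · refine hτ.integral_eq_sum_jumps (finite_range s) (fun k ↦
      ⟨boundaryExtension κ ε T (τ k.castSucc) (τ k.succ) α X, ?_, ?_⟩) ?_ h4
    · have hT : 0 < T := by
        have := hτ.lt k
        linarith [(hτ.mem_Icc k.castSucc).1, (hτ.mem_Icc k.succ).2]
      -- continuity holds on the intersections with the pieces of `s`, a finite closed cover
      refine ((locallyFinite_of_finite fun j : Fin m ↦ Icc (s j.castSucc) (s j.succ)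
        ∩ Icc (τ k.castSucc) (τ k.succ)).continuousOn_iUnion
        (fun j ↦ isClosed_Icc.inter isClosed_Icc) fun j ↦
          continuousOn_boundaryExtension hε (hs.lt j) (hsT j) hα1 (hα j) hX (hτ.lt k)
            (hx k)).mono fun t ht ↦ ?_
      obtain ⟨j, hj⟩ := hs.exists_mem_Icc hT (hτ.Icc_subset k ht)
      exact mem_iUnion.2 ⟨j, hj, ht⟩
    · intro t ht
      obtain ⟨j, hj⟩ := hs.exists_mem_Ioo
        ⟨(hτ.mem_Icc _).1.trans_lt ht.1.1, ht.1.2.trans_le (hτ.mem_Icc _).2⟩ ht.2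
      exact boundaryTerm_eq_boundaryExtension hε (hs.lt j) (hsT j) hα1 (hα j) hX
        (hτ.Icc_subset k) hj ht.1
    · intro t ht
      obtain ⟨j, hj⟩ := hs.exists_mem_Ioo ht.1 ht.2
      exact (hasDerivAt_boundaryTerm hε (hs.lt j) (hsT j) (hα j) hX
        hj).differentiableAt.hasDerivAt

end SingleAgentPieces

/-! ### The first variation of the potential energy -/

section Potential

variable {E : Type*} [NormedAddCommGroup E] [NormedSpace ℝ E]
  {M : Type*} [TopologicalSpace M] [ChartedSpace E M] {n : ℕ} {V : (Fin n → M) → ℝ}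

/-- A `C^1` function on `M^n` near a point `p`, in the product of the charts at the components of
`p`. -/
theorem exists_contDiffAt_of_contMDiffAt_pi {p : Fin n → M}
    (hV : ContMDiffAt (ModelWithCorners.pi fun _ : Fin n ↦ 𝓘(ℝ, E)) 𝓘(ℝ, ℝ) 1 V p) :
    ∃ V' : (Fin n → E) → ℝ, ContDiffAt ℝ 1 V' (fun i ↦ extChartAt 𝓘(ℝ, E) (p i) (p i)) ∧
      ∀ y : Fin n → M, (∀ i, y i ∈ (chartAt E (p i)).source) →
        V y = V' fun i ↦ extChartAt 𝓘(ℝ, E) (p i) (y i) := by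
  refine ⟨fun w ↦ V fun i ↦ (extChartAt 𝓘(ℝ, E) (p i)).symm (w i), ?_, fun y hy ↦ ?_⟩
  · have h := (contMDiffWithinAt_iff.1 hV).2
    have hr : range (ModelWithCorners.pi fun _ : Fin n ↦ 𝓘(ℝ, E)) = univ :=
      eq_univ_of_forall fun w ↦ ⟨w, rfl⟩
    rw [preimage_univ, univ_inter, hr] at h
    exact contDiffWithinAt_univ.1 h
  · refine congrArg V (funext fun i ↦ ?_)
    exact ((extChartAt 𝓘(ℝ, E) (p i)).left_inv (by simpa using hy i)).symm

theorem contDiffWithinAt_potential [IsManifold 𝓘(ℝ, E) ∞ M] {P : Type*} [NormedAddCommGroup P]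
    [NormedSpace ℝ P] {f : Fin n → P → M} {D : Set P} {z : P}
    (hf : ∀ i, ContMDiffWithinAt 𝓘(ℝ, P) 𝓘(ℝ, E) 1 (f i) D z)
    (hV : ContMDiffAt (ModelWithCorners.pi fun _ : Fin n ↦ 𝓘(ℝ, E)) 𝓘(ℝ, ℝ) 1 V
      (fun i ↦ f i z)) :
    ContDiffWithinAt ℝ 1 (fun z ↦ V fun i ↦ f i z) D z := by
  obtain ⟨V', hV', hVV'⟩ := exists_contDiffAt_of_contMDiffAt_pi hV
  have hc : ContDiffWithinAt ℝ 1 (fun z' i ↦ extChartAt 𝓘(ℝ, E) (f i z) (f i z')) D z :=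
    contDiffWithinAt_pi.2 fun i ↦ contDiffWithinAt_extChartAt_comp (mem_chart_source E _) (hf i)
  refine (ContDiffAt.comp_contDiffWithinAt z hV' hc).congr_of_eventuallyEq ?_
    (hVV' _ fun i ↦ mem_chart_source E _)
  have hs : ∀ᶠ z' in 𝓝[D] z, ∀ i, f i z' ∈ (chartAt E (f i z)).source :=
    eventually_all.2 fun i ↦ (hf i).continuousWithinAt.eventually (chart_source_mem_nhds E _)
  filter_upwards [hs] with z' hz'
  exact hVV' _ hz'

/-- The gradient represents the differential of the partial function. -/
theorem inner_partialGrad [IsManifold 𝓘(ℝ, E) ∞ M]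
    [RiemannianBundle (fun q : M ↦ TangentSpace 𝓘(ℝ, E) q)] [FiniteDimensional ℝ E]
    (i : Fin n) (z : Fin n → M) (v : TangentSpace 𝓘(ℝ, E) (z i)) :
    inner ℝ v (partialGrad V i z)
      = mvfderiv 𝓘(ℝ, E) (fun y : M ↦ V (Function.update z i y)) (z i) v := by
  have : FiniteDimensional ℝ (TangentSpace 𝓘(ℝ, E) (z i)) :=
    inferInstanceAs (FiniteDimensional ℝ E)
  have : CompleteSpace (TangentSpace 𝓘(ℝ, E) (z i)) := FiniteDimensional.complete ℝ _
  rw [real_inner_comm, partialGrad, InnerProductSpace.toDual_symm_apply]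

/-- The chain rule for a function of several points of a manifold, in terms of its partial
gradients. -/
theorem hasDerivAt_potential [IsManifold 𝓘(ℝ, E) ∞ M]
    [RiemannianBundle (fun q : M ↦ TangentSpace 𝓘(ℝ, E) q)] [FiniteDimensional ℝ E]
    {γ : Fin n → ℝ → M} {r : ℝ} (hγ : ∀ i, ContMDiffAt 𝓘(ℝ, ℝ) 𝓘(ℝ, E) 1 (γ i) r)
    (hV : ContMDiffAt (ModelWithCorners.pi fun _ : Fin n ↦ 𝓘(ℝ, E)) 𝓘(ℝ, ℝ) 1 V
      (fun i ↦ γ i r)) :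
    HasDerivAt (fun r ↦ V fun i ↦ γ i r)
      (∑ i, inner ℝ (velocity (E := E) univ (γ i) r) (partialGrad V i fun k ↦ γ k r)) r := by
  set p : Fin n → M := fun i ↦ γ i r with hp
  obtain ⟨V', hV', hVV'⟩ := exists_contDiffAt_of_contMDiffAt_pi hV
  set w : Fin n → E := fun i ↦ extChartAt 𝓘(ℝ, E) (p i) (p i) with hw
  have hV'd : HasFDerivAt V' (fderiv ℝ V' w) w := (hV'.differentiableAt one_ne_zero).hasFDerivAt
  have hs : ∀ᶠ r' in 𝓝 r, ∀ i, γ i r' ∈ (chartAt E (p i)).source :=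
    eventually_all.2 fun i ↦ (hγ i).continuousAt.eventually (chart_source_mem_nhds E _)
  -- the coordinates of the curves
  set c' : Fin n → E := fun i ↦ deriv (fun r' ↦ extChartAt 𝓘(ℝ, E) (p i) (γ i r')) r with hc'
  have hc : ∀ i, HasDerivAt (fun r' ↦ extChartAt 𝓘(ℝ, E) (p i) (γ i r')) (c' i) r := fun i ↦ by
    have h := contDiffWithinAt_extChartAt_comp (f := γ i) (z := r) (mem_chart_source E (p i))
      ((hγ i).contMDiffWithinAt (s := univ))
    exact ((contDiffWithinAt_univ.1 h).differentiableAt one_ne_zero).hasDerivAt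
  have hpart : ∀ i, inner ℝ (velocity (E := E) univ (γ i) r) (partialGrad V i p)
      = fderiv ℝ V' w (Pi.single i (c' i)) := by
    intro i
    have hupd : ∀ y ∈ (chartAt E (p i)).source, V (Function.update p i y)
        = V' (Function.update w i (extChartAt 𝓘(ℝ, E) (p i) y)) := by
      intro y hy
      rw [hVV']
      · refine congrArg V' (funext fun k ↦ ?_)
        rcases eq_or_ne k i with rfl | hk
        · simp
        · simp [hk, hw]
      · intro k
        rcases eq_or_ne k i with rfl | hk
        · simpa using hy
        · simp [hk]
    have hg : HasFDerivAt (fun e : E ↦ V' (Function.update w i e))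
        ((fderiv ℝ V' w).comp (ContinuousLinearMap.single ℝ (fun _ : Fin n ↦ E) i)) (w i) := by
      have h1 : HasFDerivAt (Function.update w i)
          (ContinuousLinearMap.single ℝ (fun _ : Fin n ↦ E) i) (w i) := by
        have := hasFDerivAt_update (𝕜 := ℝ) w (i := i) (w i)
        convert this using 1
        ext e k
        rcases eq_or_ne k i with rfl | hk
        · simp
        · simp [hk]
      have h2 : HasFDerivAt V' (fderiv ℝ V' w) (Function.update w i (w i)) := by
        rwa [Function.update_eq_self]
      exact h2.comp (w i) h1
    -- the partial function is differentiable, so its derivative along the curve is given by its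
    -- differential
    have hW : MDifferentiableAt 𝓘(ℝ, E) 𝓘(ℝ, ℝ) (fun y : M ↦ V (Function.update p i y)) (p i) := by
      have h1 : MDifferentiableAt 𝓘(ℝ, E) 𝓘(ℝ, ℝ)
          ((fun e : E ↦ V' (Function.update w i e)) ∘ extChartAt 𝓘(ℝ, E) (p i)) (p i) :=
        hg.differentiableAt.mdifferentiableAt.comp (p i)
          (mdifferentiableAt_extChartAt (mem_chart_source E (p i)))
      refine h1.congr_of_eventuallyEq ?_
      filter_upwards [chart_source_mem_nhds E (p i)] with y hy
      exact hupd y hy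
    have hγd : MDifferentiableAt 𝓘(ℝ, ℝ) 𝓘(ℝ, E) (γ i) r :=
      (hγ i).mdifferentiableAt one_ne_zero
    have h1 : HasDerivAt (fun r' ↦ V (Function.update p i (γ i r')))
        (mvfderiv 𝓘(ℝ, E) (fun y : M ↦ V (Function.update p i y)) (p i)
          (velocity univ (γ i) r)) r := by
      have h2 : HasFDerivAt (𝕜 := ℝ) (fun r' ↦ V (Function.update p i (γ i r')))
          ((mvfderiv 𝓘(ℝ, E) (fun y : M ↦ V (Function.update p i y)) (p i)).comp
            (mfderiv 𝓘(ℝ, ℝ) 𝓘(ℝ, E) (γ i) r) : ℝ →L[ℝ] ℝ) r :=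
        (hW.hasMFDerivAt.comp r hγd.hasMFDerivAt).hasFDerivAt
      rw [velocity, mfderivWithin_univ]
      exact h2.hasDerivAt
    have h3 : HasDerivAt (fun r' ↦ V (Function.update p i (γ i r')))
        (fderiv ℝ V' w (Pi.single i (c' i))) r := by
      refine (hg.comp_hasDerivAt r (hc i)).congr_of_eventuallyEq ?_
      filter_upwards [hs] with r' hr'
      exact hupd _ (hr' i)
    exact (inner_partialGrad i p _).trans (h1.unique h3)
  rw [Finset.sum_congr rfl fun i _ ↦ hpart i, ← map_sum, Finset.univ_sum_single]
  refine (hV'd.comp_hasDerivAt r (hasDerivAt_pi.2 hc)).congr_of_eventuallyEq ?_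
  filter_upwards [hs] with r' hr'
  exact hVV' _ hr'

/-- The first variation formula for the potential energy. -/
theorem firstVariation_potential [IsManifold 𝓘(ℝ, E) ∞ M]
    [RiemannianBundle (fun q : M ↦ TangentSpace 𝓘(ℝ, E) q)] [FiniteDimensional ℝ E]
    {T ε : ℝ} (hT : 0 < T) (hε : 0 < ε) {U : Set (Fin n → M)} (hU : IsOpen U)
    (hV : ContMDiffOn (ModelWithCorners.pi fun _ : Fin n ↦ 𝓘(ℝ, E)) 𝓘(ℝ, ℝ) 1 V U)
    {α : Fin n → ℝ → ℝ → M}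
    (hα : ∀ i, ContMDiffOn 𝓘(ℝ, ℝ × ℝ) 𝓘(ℝ, E) 1 (Function.uncurry (α i))
      (Ioo (-ε) ε ×ˢ Icc 0 T))
    (hαU : ∀ t ∈ Icc 0 T, (fun i ↦ α i 0 t) ∈ U) :
    (∀ᶠ r in 𝓝 (0 : ℝ), IntervalIntegrable (fun t ↦ V fun i ↦ α i r t) volume 0 T) ∧
    IntervalIntegrable (fun t ↦ ∑ i, inner ℝ (velocity (E := E) univ (fun r ↦ α i r t) 0)
      (partialGrad V i fun k ↦ α k 0 t)) volume 0 T ∧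
    HasDerivAt (fun r ↦ ∫ t in (0 : ℝ)..T, V fun i ↦ α i r t)
      (∫ t in (0 : ℝ)..T, ∑ i, inner ℝ (velocity (E := E) univ (fun r ↦ α i r t) 0)
        (partialGrad V i fun k ↦ α k 0 t)) 0 := by
  set D : Set (ℝ × ℝ) := Ioo (-ε) ε ×ˢ Icc 0 T with hD
  have h0 : (0 : ℝ) ∈ Ioo (-ε) ε := ⟨by linarith, hε⟩
  set A : ℝ × ℝ → Fin n → M := fun z i ↦ Function.uncurry (α i) z with hA
  have hAc : ContinuousOn A D := continuousOn_pi.2 fun i ↦ (hα i).continuousOn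
  -- by compactness, the nearby curves stay in `U`
  obtain ⟨δ, hδ, hδε, hδU⟩ : ∃ δ > 0, Ioo (-δ) δ ⊆ Ioo (-ε) ε ∧
      ∀ z ∈ Ioo (-δ) δ ×ˢ Icc 0 T, A z ∈ U := by
    obtain ⟨O, hO, hOU⟩ := continuousOn_iff'.1 hAc U hU
    obtain ⟨u, v, hu, -, h0u, hv, huv⟩ := generalized_tube_lemma
      (isCompact_singleton (x := (0 : ℝ))) (isCompact_Icc (a := (0 : ℝ)) (b := T)) hO (by
        rintro ⟨r, t⟩ ⟨hr, ht⟩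
        obtain rfl : r = 0 := hr
        exact (hOU.subset ⟨hαU t ht, mk_mem_prod h0 ht⟩).1)
    obtain ⟨δ, hδ, hδu⟩ := Metric.isOpen_iff.1 hu 0 (h0u rfl)
    refine ⟨min δ ε, lt_min hδ hε, Ioo_subset_Ioo (neg_le_neg (min_le_right _ _))
      (min_le_right _ _), fun z hz ↦ ?_⟩
    have hz1 : z.1 ∈ u := hδu (by
      rw [Real.ball_eq_Ioo, zero_sub, zero_add]
      exact Ioo_subset_Ioo (neg_le_neg (min_le_left _ _)) (min_le_left _ _) hz.1)
    have hzD : z ∈ D := ⟨Ioo_subset_Ioo (neg_le_neg (min_le_right _ _)) (min_le_right _ _) hz.1,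
      hz.2⟩
    exact (hOU.superset ⟨huv ⟨hz1, hv hz.2⟩, hzD⟩).1
  have hδD : Ioo (-δ) δ ×ˢ Icc 0 T ⊆ D := prod_mono hδε subset_rfl
  have hδ0 : Ioo (-δ) δ ∈ 𝓝 (0 : ℝ) := Ioo_mem_nhds (by linarith) hδ
  have hVA : ContDiffOn ℝ 1 (fun z ↦ V (A z)) (Ioo (-δ) δ ×ˢ Icc 0 T) := fun z hz ↦
    (contDiffWithinAt_potential (fun i ↦ hα i z (hδD hz))
      (hV.contMDiffAt (hU.mem_nhds (hδU z hz)))).mono hδD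
  obtain ⟨h1, h2, h3⟩ := hasDerivAt_integral_strip hδ hT hVA
  have hderiv : ∀ t ∈ Icc 0 T, deriv (fun r ↦ V (A (r, t))) 0
      = ∑ i, inner ℝ (velocity (E := E) univ (fun r ↦ α i r t) 0)
          (partialGrad V i fun k ↦ α k 0 t) := by
    intro t ht
    refine (hasDerivAt_potential (γ := fun i r ↦ α i r t) (fun i ↦ ?_)
      (hV.contMDiffAt (hU.mem_nhds (hαU t ht)))).deriv
    have hl : ContMDiffWithinAt 𝓘(ℝ, ℝ) 𝓘(ℝ, ℝ × ℝ) 1 (fun r : ℝ ↦ ((r, t) : ℝ × ℝ))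
        (Ioo (-ε) ε) 0 := by
      rw [contMDiffWithinAt_iff_contDiffWithinAt]; fun_prop
    exact ((hα i (0, t) (mk_mem_prod h0 ht)).comp 0 hl (mapsTo_prodMk_left ht)).contMDiffAt
      (isOpen_Ioo.mem_nhds h0)
  refine ⟨?_, h2.congr_uIoo fun t ht ↦ ?_, ?_⟩
  · filter_upwards [hδ0] with r hr
    exact h1 r hr
  · rw [uIoo_of_le hT.le] at ht
    exact hderiv t (Ioo_subset_Icc_self ht)
  · rw [← intervalIntegral.integral_congr (μ := volume)
      (f := fun t ↦ deriv (fun r ↦ V (A (r, t))) 0) fun t ht ↦ ?_]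
    · exact h3
    · rw [uIcc_of_le hT.le] at ht
      exact hderiv t ht

end Potential

end MultiAgent

end

/-! ### The first variation formula -/

theorem theorem1
    -- the Riemannian manifold `M`
    {E : Type*} [NormedAddCommGroup E] [NormedSpace ℝ E] [FiniteDimensional ℝ E]
    {M : Type*} [TopologicalSpace M] [T2Space M] [ChartedSpace E M] [IsManifold 𝓘(ℝ, E) ∞ M]
    [RiemannianBundle (fun p : M ↦ TangentSpace 𝓘(ℝ, E) p)]
    [IsContMDiffRiemannianBundle 𝓘(ℝ, E) ∞ E (fun p : M ↦ TangentSpace 𝓘(ℝ, E) p)]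
    -- the submanifold `S = ι(N)`
    {F : Type*} [NormedAddCommGroup F] [NormedSpace ℝ F] [FiniteDimensional ℝ F]
    {N : Type*} [TopologicalSpace N] [ChartedSpace F N] [IsManifold 𝓘(ℝ, F) ∞ N]
    (ι : N → M) (hι : Manifold.IsSmoothEmbedding 𝓘(ℝ, F) 𝓘(ℝ, E) ∞ ι)
    -- the energy and the boundary data
    {n : ℕ} (κ T : ℝ) (hT : 0 < T)
    (V : (Fin n → M) → ℝ) (U : Set (Fin n → M)) (hU : IsOpen U)
    (hV : ContMDiffOn (ModelWithCorners.pi fun _ : Fin n ↦ 𝓘(ℝ, E)) 𝓘(ℝ, ℝ) 1 V U)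
    (P : Fin n → TangentBundle 𝓘(ℝ, E) M) (q : Fin n → N)
    -- the trajectories
    (x : Fin n → ℝ → M)
    (hx : ∀ i, MultiAgent.IsAdmissibleCurve (F := F) T ι (P i) (q i) (x i))
    (hxU : ∀ t ∈ Icc 0 T, (fun i ↦ x i t) ∈ U)
    -- the variations and their variational vector fields
    (ε : ℝ) (hε : 0 < ε) (α : Fin n → ℝ → ℝ → M)
    (hα : ∀ i, MultiAgent.IsAdmissibleVariation (F := F) T ι (P i) (q i) (x i) ε (α i))
    (X : (i : Fin n) → (t : ℝ) → TangentSpace 𝓘(ℝ, E) (x i t))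
    (hX : ∀ i, MultiAgent.IsVariationField T (x i) (α i) (X i))
    -- the partitions
    (l : Fin n → ℕ) (τ : (i : Fin n) → Fin (l i + 1) → ℝ)
    (hτ : ∀ i, MultiAgent.IsPartition T (τ i))
    (hxτ : ∀ i, MultiAgent.IsSmoothOnPieces E (τ i) (x i)) :
    -- the integrals exist
    (∀ᶠ r in 𝓝 (0 : ℝ), IntervalIntegrable
      (MultiAgent.energyDensity (E := E) V κ T (fun i ↦ α i r)) volume 0 T) ∧
    IntervalIntegrable
      (fun t ↦ ∑ i, inner ℝ (X i t) (MultiAgent.eulerLagrange V κ T x i t)) volume 0 T ∧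
    -- the one-sided limits of the boundary terms exist, and the first variation formula holds
    ∃ bLeft bRight : (i : Fin n) → Fin (l i) → ℝ,
      (∀ i j, Tendsto (MultiAgent.boundaryTerm κ T (x i) (X i))
        (𝓝[<] (τ i j.succ)) (𝓝 (bLeft i j))) ∧
      (∀ i j, Tendsto (MultiAgent.boundaryTerm κ T (x i) (X i))
        (𝓝[>] (τ i j.castSucc)) (𝓝 (bRight i j))) ∧
      HasDerivAt (fun r ↦ MultiAgent.energy (E := E) V κ T (fun i ↦ α i r))
        ((∫ t in (0 : ℝ)..T, ∑ i, inner ℝ (X i t) (MultiAgent.eulerLagrange V κ T x i t))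
          + ∑ i, ∑ j, (bLeft i j - bRight i j)) 0 := by
  obtain rfl : x = fun i ↦ α i 0 := funext fun i ↦ (hα i).zero.symm
  have hXα : ∀ i, ∀ t ∈ Icc 0 T, X i t = MultiAgent.velocity univ (fun r ↦ α i r t) 0 :=
    fun i t ht ↦ eq_of_heq (TotalSpace.mk.inj (hX i t ht)).2
  choose m s hs hαs using fun i ↦ (hα i).piecewise
  have h := fun i ↦ MultiAgent.firstVariation_agent (κ := κ) hε (hα i).contMDiffOn (hs i) (hαs i)
    (hXα i) (hτ i) (hxτ i)
  choose h1 h2 h3 h4 h5 bLeft bRight hLeft hRight hjump using h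
  obtain ⟨p1, p2, p3⟩ := MultiAgent.firstVariation_potential hT hε hU hV
    (fun i ↦ (hα i).contMDiffOn) hxU
  have hsplit : ∀ r, MultiAgent.energyDensity (E := E) V κ T (fun i ↦ α i r)
      = fun t ↦ (∑ i, MultiAgent.agentDensity (E := E) κ T (α i r) t) + V fun i ↦ α i r t := by
    intro r
    funext t
    simp only [MultiAgent.energyDensity, MultiAgent.agentDensity, Finset.mul_sum]
  have h0 : Ioo (-ε) ε ∈ 𝓝 (0 : ℝ) := Ioo_mem_nhds (by linarith) hε
  have hsum : ∀ r ∈ Ioo (-ε) ε, IntervalIntegrable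
      (fun t ↦ ∑ i, MultiAgent.agentDensity (E := E) κ T (α i r) t) volume 0 T := fun r hr ↦
    (IntervalIntegrable.sum Finset.univ fun i _ ↦ h1 i r hr).congr fun t _ ↦ by
      simp only [Finset.sum_apply]
  have hdiff : ∀ i, IntervalIntegrable (fun t ↦
      deriv (fun r ↦ MultiAgent.agentDensity (E := E) κ T (α i r) t) 0
        - deriv (MultiAgent.boundaryTerm κ T (α i 0) (X i)) t) volume 0 T := fun i ↦
    (h2 i).sub (h4 i)
  have hdsum : IntervalIntegrable (fun t ↦ ∑ i,
      (deriv (fun r ↦ MultiAgent.agentDensity (E := E) κ T (α i r) t) 0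
        - deriv (MultiAgent.boundaryTerm κ T (α i 0) (X i)) t)) volume 0 T :=
    (IntervalIntegrable.sum Finset.univ fun i _ ↦ hdiff i).congr fun t _ ↦ by
      simp only [Finset.sum_apply]
  -- the Euler-Lagrange expression, off the break points of the variations
  have hEL : ∀ᵐ t ∂volume, t ∈ uIoc 0 T →
      (∑ i, (deriv (fun r ↦ MultiAgent.agentDensity (E := E) κ T (α i r) t) 0
        - deriv (MultiAgent.boundaryTerm κ T (α i 0) (X i)) t))
      + ∑ i, inner ℝ (MultiAgent.velocity (E := E) univ (fun r ↦ α i r t) 0)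
          (MultiAgent.partialGrad V i fun k ↦ α k 0 t)
      = ∑ i, inner ℝ (X i t) (MultiAgent.eulerLagrange V κ T (fun i ↦ α i 0) i t) := by
    have hfin : ((⋃ i, range (s i)) ∪ {T}).Finite :=
      (finite_iUnion fun i ↦ finite_range (s i)).union (finite_singleton T)
    filter_upwards [compl_mem_ae_iff.2 (hfin.measure_zero volume)] with t ht htT
    rw [uIoc_of_le hT.le] at htT
    simp only [mem_compl_iff, mem_union, mem_iUnion, mem_singleton_iff, not_or, not_exists] at ht
    have htI : t ∈ Ioo 0 T := ⟨htT.1, lt_of_le_of_ne htT.2 ht.2⟩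
    rw [← Finset.sum_add_distrib]
    refine Finset.sum_congr rfl fun i _ ↦ ?_
    rw [h5 i t ⟨htI, ht.1 i⟩, add_sub_cancel_right, ← hXα i t (Ioo_subset_Icc_self htI)]
    exact (inner_add_right _ _ _).symm
  refine ⟨?_, ?_, bLeft, bRight, hLeft, hRight, ?_⟩
  · filter_upwards [h0, p1] with r hr hpr
    rw [hsplit]
    exact (hsum r hr).add hpr
  · exact (hdsum.add p2).congr_ae ((ae_restrict_iff' measurableSet_uIoc).2 hEL)
  · have hval : (∑ i, ∫ t in (0 : ℝ)..T,
          deriv (fun r ↦ MultiAgent.agentDensity (E := E) κ T (α i r) t) 0)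
        + (∫ t in (0 : ℝ)..T, ∑ i, inner ℝ
            (MultiAgent.velocity (E := E) univ (fun r ↦ α i r t) 0)
            (MultiAgent.partialGrad V i fun k ↦ α k 0 t))
        = (∫ t in (0 : ℝ)..T, ∑ i, inner ℝ (X i t)
            (MultiAgent.eulerLagrange V κ T (fun i ↦ α i 0) i t))
          + ∑ i, ∑ j, (bLeft i j - bRight i j) := by
      rw [← intervalIntegral.integral_congr_ae hEL, intervalIntegral.integral_add hdsum p2,
        intervalIntegral.integral_finsetSum fun i _ ↦ hdiff i,
        Finset.sum_congr rfl fun i _ ↦ intervalIntegral.integral_sub (h2 i) (h4 i),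
        Finset.sum_sub_distrib, Finset.sum_congr rfl fun i _ ↦ hjump i]
      ring
    rw [← hval]
    refine ((HasDerivAt.fun_sum (u := Finset.univ) fun i _ ↦ h3 i).add p3).congr_of_eventuallyEq ?_
    filter_upwards [h0, p1] with r hr hpr
    rw [MultiAgent.energy, hsplit, intervalIntegral.integral_add (hsum r hr) hpr,
      intervalIntegral.integral_finsetSum fun i _ ↦ h1 i r hr]
    rfl
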